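/- Let $\beta>0$ be a real number and let $d$ be a positive integer, both fixed. For a partition $\lambda$ let $\ell(\lambda)$ be its number of non-zero parts and let $f^\lambda$ be the number of standard Young tableaux of shape $\lambda$. Then, as $n\to\infty$, $$\sum_{\lambda\vdash n,\ \ell(\lambda)\le d}(f^\lambda)^\beta \;\sim\; \Bigl((2\pi)^{-\frac{d-1}{2}}\, d^{\,n+\frac{d^2}{2}}\, n^{-\frac{(d-1)(d+2)}{4}}\Bigr)^{\beta}\, n^{\frac{d-1}{2}}\, Z'_d(\beta),$$ that is, the ratio of the two sides tends to $1$, where $$Z'_d(\beta)=\int_{\mathfrak H_d} e^{-\frac{d\beta}{2}(x_1^2+\cdots+x_d^2)}\prod_{1\le i<j\le d}(x_i-x_j)^\beta\,dx_1\cdots dx_{d-1},$$ $$\mathfrak H_d=\{(x_1,\dots,x_d)\in\mathbb R^d : x_1\ge\cdots\ge x_d,\ x_1+\cdots+x_d=0\},$$ and the integral runs over the $(x_1,\dots,x_{d-1})\in\mathbb R^{d-1}$ such that $(x_1,\dots,x_d)\in\mathfrak H_d$ with $x_d:=-(x_1+\cdots+x_{d-1})$ (for $d=1$ the integral is $1$).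 -/

import Mathlib

/-- A semistandard tableau of shape `μ` is standard if its entries are `1, …, |μ|`, each used
exactly once (so that the weakly increasing rows are in fact strictly increasing). -/
def IsStandardTableau {μ : YoungDiagram} (T : SemistandardYoungTableau μ) : Prop :=
  Set.BijOn (fun c : ℕ × ℕ => T c.1 c.2) (μ.cells : Set (ℕ × ℕ)) (Set.Icc 1 μ.card)

/-- The number `f^μ` of standard Young tableaux of shape `μ`. -/
noncomputable def numStandardTableaux (μ : YoungDiagram) : ℕ :=
  Nat.card {T : SemistandardYoungTableau μ // IsStandardTableau T}

/-- There are finitely many partitions of `n` with at most `d` rows (`μ.colLen 0` is the number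
of non-empty rows of the Young diagram `μ`). -/
theorem finite_partitions (n d : ℕ) :
    {μ : YoungDiagram | μ.card = n ∧ μ.colLen 0 ≤ d}.Finite := by
  refine Set.Finite.of_injOn (f := YoungDiagram.cells)
    (t := (((Finset.range n ×ˢ Finset.range n).powerset : Finset (Finset (ℕ × ℕ))) :
      Set (Finset (ℕ × ℕ)))) ?_ ?_ (Finset.finite_toSet _)
  · rintro μ ⟨hμ, -⟩
    simp only [Finset.coe_powerset, Set.mem_preimage, Set.mem_powerset_iff, Finset.coe_subset]
    rintro ⟨i, j⟩ hc
    rw [YoungDiagram.mem_cells] at hc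
    have h1 : j < μ.rowLen i := YoungDiagram.mem_iff_lt_rowLen.1 hc
    have h2 : i < μ.colLen j := YoungDiagram.mem_iff_lt_colLen.1 hc
    have h3 : μ.rowLen i ≤ μ.card := by
      rw [YoungDiagram.rowLen_eq_card]
      exact Finset.card_le_card (Finset.filter_subset _ _)
    have h4 : μ.colLen j ≤ μ.card := by
      rw [YoungDiagram.colLen_eq_card]
      exact Finset.card_le_card (Finset.filter_subset _ _)
    simp only [Finset.mem_product, Finset.mem_range]
    omega
  · intro μ _ ν _ h
    exact YoungDiagram.ext h

/-- The set `P_n(d)` of partitions of `n` of length at most `d`. -/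
noncomputable def partitionsOfLengthLE (n d : ℕ) : Finset YoungDiagram :=
  (finite_partitions n d).toFinset

/-- The chamber `x_1 ≥ ⋯ ≥ x_d`, `x_1 + ⋯ + x_d = 0`. -/
def tracelessChamber (d : ℕ) : Set (Fin d → ℝ) :=
  {x | Antitone x ∧ ∑ i, x i = 0}

/-- The point `(x_1, …, x_{d-1}, x_d)` with `x_d = -(x_1 + ⋯ + x_{d-1})`. -/
def tracelessPoint (d : ℕ) (x : Fin (d - 1) → ℝ) : Fin d → ℝ :=
  fun i => if h : i.1 < d - 1 then x ⟨i.1, h⟩ else -∑ k, x k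

/-- The function `exp(-(dβ/2) ∑ x_i²) ∏_{i<j} (x_i - x_j)^β`. -/
noncomputable def chamberDensity (d : ℕ) (β : ℝ) (x : Fin d → ℝ) : ℝ :=
  Real.exp (-((d : ℝ) * β / 2) * ∑ i, x i ^ 2) * ∏ i, ∏ j ∈ Finset.Ioi i, (x i - x j) ^ β

/-- The integral `Z'_d(β)` of `chamberDensity` over the traceless chamber, with respect to
`dx_1 ⋯ dx_{d-1}`. -/
noncomputable def chamberIntegral (d : ℕ) (β : ℝ) : ℝ :=
  ∫ x in {x : Fin (d - 1) → ℝ | tracelessPoint d x ∈ tracelessChamber d},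
    chamberDensity d β (tracelessPoint d x)

/-!
The branching rule and a Vandermonde-type identity give the formula of Frobenius and Young
`f^μ ∏ i, l i ! = n! ∏ i < j, (l i - l j)`, where `l i = μ i + d - i`. Up to an explicit growth
factor and a Stirling ratio tending to `1`, it expresses `f^μ` as the difference product of the
rescaled lengths `(l i - n / d) / √n` times the Poisson weights, of mean `n / d`, of the `l i`. By
the local limit theorem for the Poisson distribution this tends to the Gaussian density times the
Vandermonde product when the rescaled lengths converge. The rescaled partitions form a lattice of
mesh `1 / √n` in the traceless hyperplane, so the sum over partitions is the integral of a step
function on cubes. An exponential tail bound for the Poisson weights dominates these step functions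
uniformly in `n`, and dominated convergence gives the limit.
-/

open Filter Topology MeasureTheory

section YoungDiagrams

variable {μ : YoungDiagram} {c : ℕ × ℕ}

/-- The Young diagram obtained from `μ` by removing the corner `c`. To make this total in `c`, all
cells weakly below and to the right of `c` are removed; at a corner this is just `c` itself. -/
def removeCorner (μ : YoungDiagram) (c : ℕ × ℕ) : YoungDiagram where
  cells := {x ∈ μ.cells | ¬ c ≤ x}
  isLowerSet x y hyx hx := by
    simp only [Finset.coe_filter, YoungDiagram.mem_cells, Set.mem_ofPred_eq] at hx ⊢
    exact ⟨μ.isLowerSet hyx hx.1, fun hcy => hx.2 (hcy.trans hyx)⟩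

theorem notMem_removeCorner : c ∉ removeCorner μ c :=
  fun h => (Finset.mem_filter.1 h).2 le_rfl

theorem insert_cells_removeCorner (hc : Maximal (· ∈ μ) c) :
    insert c (removeCorner μ c).cells = μ.cells := by
  ext x
  simp only [removeCorner, Finset.mem_insert, Finset.mem_filter, YoungDiagram.mem_cells]
  constructor
  · rintro (rfl | hx)
    exacts [hc.prop, hx.1]
  · exact fun hx => or_iff_not_imp_left.2 fun hxc => ⟨hx, fun hcx => hxc (hc.eq_of_ge hx hcx)⟩

theorem mem_removeCorner (hc : Maximal (· ∈ μ) c) {x : ℕ × ℕ} :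
    x ∈ removeCorner μ c ↔ x ≠ c ∧ x ∈ μ := by
  rw [← YoungDiagram.mem_cells (μ := μ), ← insert_cells_removeCorner hc, Finset.mem_insert,
    YoungDiagram.mem_cells]
  constructor
  · exact fun hx => ⟨ne_of_mem_of_not_mem hx notMem_removeCorner, Or.inr hx⟩
  · exact fun hx => hx.2.resolve_left hx.1

theorem card_removeCorner (hc : Maximal (· ∈ μ) c) : (removeCorner μ c).card + 1 = μ.card := by
  rw [YoungDiagram.card, YoungDiagram.card, ← insert_cells_removeCorner hc,
    Finset.card_insert_of_notMem notMem_removeCorner]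

theorem maximal_mem_youngDiagram_iff {i j : ℕ} :
    Maximal (· ∈ μ) (i, j) ↔ μ.rowLen (i + 1) < μ.rowLen i ∧ j = μ.rowLen i - 1 := by
  simp only [Maximal, Prod.forall, Prod.mk_le_mk, YoungDiagram.mem_iff_lt_rowLen]
  constructor
  · rintro ⟨hij, hmax⟩
    have hbelow : ¬ j < μ.rowLen (i + 1) := fun h => by
      have := (hmax (i + 1) j h ⟨i.le_succ, le_rfl⟩).1
      omega
    have hright : ¬ j + 1 < μ.rowLen i := fun h => by
      have := (hmax i (j + 1) h ⟨le_rfl, j.le_succ⟩).2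
      omega
    omega
  · rintro ⟨hlt, rfl⟩
    refine ⟨by omega, fun a b hb ⟨hia, _⟩ => ?_⟩
    rcases hia.eq_or_lt with rfl | hia
    · omega
    · have := μ.rowLen_anti (i + 1) a hia
      omega

theorem rowLen_removeCorner {i : ℕ} (hi : μ.rowLen (i + 1) < μ.rowLen i) (k : ℕ) :
    (removeCorner μ (i, μ.rowLen i - 1)).rowLen k =
      if k = i then μ.rowLen k - 1 else μ.rowLen k := by
  refine eq_of_forall_lt_iff fun j => ?_
  rw [← YoungDiagram.mem_iff_lt_rowLen, mem_removeCorner (maximal_mem_youngDiagram_iff.2 ⟨hi, rfl⟩),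
    YoungDiagram.mem_iff_lt_rowLen, Ne, Prod.mk.injEq]
  split_ifs with h
  · subst h
    omega
  · simp [h]

theorem colLen_zero_le_iff_rowLen_eq_zero {d : ℕ} : μ.colLen 0 ≤ d ↔ μ.rowLen d = 0 := by
  rw [← not_lt, ← YoungDiagram.mem_iff_lt_colLen, YoungDiagram.mem_iff_lt_rowLen, not_lt,
    Nat.le_zero]

theorem card_eq_sum_rowLen {d : ℕ} (hd : μ.colLen 0 ≤ d) : μ.card = ∑ i : Fin d, μ.rowLen i := by
  rw [YoungDiagram.card, Finset.card_eq_sum_card_fiberwise (f := Prod.fst) (t := Finset.range d),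
    Finset.sum_range]
  · simp only [YoungDiagram.rowLen_eq_card, YoungDiagram.row]
  · rintro ⟨i, j⟩ h
    have := YoungDiagram.mem_iff_lt_colLen.1 (μ.up_left_mem le_rfl (Nat.zero_le j) h)
    exact Finset.mem_coe.2 (Finset.mem_range.2 (by omega))

theorem youngDiagram_eq_of_rowLen_eq {ν : YoungDiagram} {d : ℕ} (hμ : μ.colLen 0 ≤ d)
    (hν : ν.colLen 0 ≤ d) (h : ∀ i : Fin d, μ.rowLen i = ν.rowLen i) : μ = ν := by
  ext ⟨i, j⟩
  rw [YoungDiagram.mem_cells, YoungDiagram.mem_cells, YoungDiagram.mem_iff_lt_rowLen,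
    YoungDiagram.mem_iff_lt_rowLen]
  rw [colLen_zero_le_iff_rowLen_eq_zero] at hμ hν
  rcases lt_or_ge i d with hi | hi
  · rw [h ⟨i, hi⟩]
  · have := μ.rowLen_anti d i hi
    have := ν.rowLen_anti d i hi
    omega

theorem exists_youngDiagram_rowLen_eq {d : ℕ} {r : Fin d → ℕ} (hr : Antitone r) :
    ∃ μ : YoungDiagram, μ.colLen 0 ≤ d ∧ ∀ i : Fin d, μ.rowLen i = r i := by
  refine ⟨YoungDiagram.ofRowLens (List.ofFn r) hr.sortedGE_ofFn, ?_, fun i => ?_⟩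
  · rw [← not_lt, ← YoungDiagram.mem_iff_lt_colLen, YoungDiagram.mem_ofRowLens]
    rintro ⟨h, -⟩
    exact (List.length_ofFn ▸ h).false
  · have h := YoungDiagram.rowLen_ofRowLens (hw := hr.sortedGE_ofFn)
      (⟨i, by rw [List.length_ofFn]; exact i.2⟩ : Fin (List.ofFn r).length)
    rwa [Fin.getElem_fin, List.getElem_ofFn] at h

theorem mem_partitionsOfLengthLE {n d : ℕ} :
    μ ∈ partitionsOfLengthLE n d ↔ μ.card = n ∧ μ.colLen 0 ≤ d :=
  Set.Finite.mem_toFinset _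

end YoungDiagrams

section BranchingRule

variable {μ : YoungDiagram} {c : ℕ × ℕ}

instance finite_standardTableaux (μ : YoungDiagram) :
    Finite {T : SemistandardYoungTableau μ // IsStandardTableau T} := by
  refine Finite.of_injective (β := μ.cells → Set.Icc 1 μ.card)
    (fun T x => ⟨T.1 x.1.1 x.1.2, T.2.mapsTo x.2⟩) fun T T' h => ?_
  refine Subtype.ext (SemistandardYoungTableau.ext fun i j => ?_)
  by_cases hx : (i, j) ∈ μ
  · exact congrArg Subtype.val (congrFun h ⟨(i, j), hx⟩)
  · rw [T.1.zeros hx, T'.1.zeros hx]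

theorem tableau_monotone (T : SemistandardYoungTableau μ) {x y : ℕ × ℕ} (hxy : x ≤ y)
    (hy : y ∈ μ) : T x.1 x.2 ≤ T y.1 y.2 :=
  (T.row_weak_of_le hxy.2 (μ.up_left_mem hxy.1 le_rfl hy)).trans (T.col_weak hxy.1 hy)

theorem IsStandardTableau.maximal {T : SemistandardYoungTableau μ} (hT : IsStandardTableau T)
    (hc : c ∈ μ) (hTc : T c.1 c.2 = μ.card) : Maximal (· ∈ μ) c := by
  refine ⟨hc, fun x hx hcx => (hT.injOn hx hc (le_antisymm ?_ (tableau_monotone T hcx hx))).le⟩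
  exact (hT.mapsTo hx).2.trans hTc.ge

/-- The restriction of a tableau to a smaller diagram. -/
def restrictTableau {ν : YoungDiagram} (T : SemistandardYoungTableau μ) (h : ν ≤ μ) :
    SemistandardYoungTableau ν where
  entry i j := if (i, j) ∈ ν then T i j else 0
  row_weak' hj hν := by
    rw [if_pos hν, if_pos (ν.up_left_mem le_rfl hj.le hν)]
    exact T.row_weak hj (h hν)
  col_strict' hi hν := by
    rw [if_pos hν, if_pos (ν.up_left_mem hi.le le_rfl hν)]
    exact T.col_strict hi (h hν)
  zeros' h := if_neg h

theorem restrictTableau_apply {ν : YoungDiagram} (T : SemistandardYoungTableau μ) (h : ν ≤ μ)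
    (i j : ℕ) : restrictTableau T h i j = if (i, j) ∈ ν then T i j else 0 := rfl

/-- The tableau of shape `μ` obtained by adding the corner `c`, with entry `N`, to a tableau with
smaller entries. -/
def extendTableau (hc : Maximal (· ∈ μ) c) (T : SemistandardYoungTableau (removeCorner μ c))
    {N : ℕ} (hN : ∀ i j, T i j < N) : SemistandardYoungTableau μ where
  entry i j := if (i, j) = c then N else T i j
  row_weak' {i j₁ j₂} hj h := by
    by_cases h₂ : (i, j₂) = c
    · rw [if_pos h₂]
      split_ifs
      exacts [le_rfl, (hN _ _).le]
    · have h₁ : (i, j₁) ≠ c := fun h₁ =>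
        h₂ (hc.eq_of_ge h (h₁ ▸ Prod.mk_le_mk.2 ⟨le_rfl, hj.le⟩))
      rw [if_neg h₁, if_neg h₂]
      exact T.row_weak hj ((mem_removeCorner hc).2 ⟨h₂, h⟩)
  col_strict' {i₁ i₂ j} hi h := by
    have h₁ : (i₁, j) ≠ c := by
      rintro rfl
      exact hi.not_ge (hc.le_of_ge h (Prod.mk_le_mk.2 ⟨hi.le, le_rfl⟩)).1
    rw [if_neg h₁]
    split_ifs with h₂
    · exact hN _ _
    · exact T.col_strict hi ((mem_removeCorner hc).2 ⟨h₂, h⟩)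
  zeros' {i j} h := by
    rw [if_neg (ne_of_mem_of_not_mem hc.prop h).symm]
    exact T.zeros fun h' => h ((mem_removeCorner hc).1 h').2

theorem extendTableau_apply (hc : Maximal (· ∈ μ) c)
    (T : SemistandardYoungTableau (removeCorner μ c)) {N : ℕ} (hN : ∀ i j, T i j < N) (i j : ℕ) :
    extendTableau hc T hN i j = if (i, j) = c then N else T i j := rfl

theorem IsStandardTableau.restrict {T : SemistandardYoungTableau μ} (hT : IsStandardTableau T)
    (hc : Maximal (· ∈ μ) c) (hTc : T c.1 c.2 = μ.card) (h : removeCorner μ c ≤ μ) :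
    IsStandardTableau (restrictTableau T h) := by
  have hbij := hT.sdiff_singleton hc.prop
  have hcells : (μ.cells : Set (ℕ × ℕ)) \ {c} = (removeCorner μ c).cells := by
    rw [← insert_cells_removeCorner hc, Finset.coe_insert]
    exact Set.insert_sdiff_self_of_notMem notMem_removeCorner
  have hentries : Set.Icc 1 μ.card \ {T c.1 c.2} = Set.Icc 1 (removeCorner μ c).card := by
    ext k
    simp only [Set.mem_sdiff, Set.mem_Icc, Set.mem_singleton_iff, hTc, ← card_removeCorner hc]
    omega
  rw [hcells, hentries] at hbij
  exact hbij.congr fun x hx => ((restrictTableau_apply T h x.1 x.2).trans (if_pos hx)).symm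

theorem IsStandardTableau.extend (hc : Maximal (· ∈ μ) c)
    {T : SemistandardYoungTableau (removeCorner μ c)} (hT : IsStandardTableau T)
    (hN : ∀ i j, T i j < μ.card) : IsStandardTableau (extendTableau hc T hN) := by
  have hold : Set.EqOn (fun x : ℕ × ℕ => T x.1 x.2) (fun x => extendTableau hc T hN x.1 x.2)
      (removeCorner μ c).cells :=
    fun x hx => (if_neg (ne_of_mem_of_not_mem hx notMem_removeCorner)).symm
  have hnew : extendTableau hc T hN c.1 c.2 = μ.card := if_pos rfl
  have hbij := (hT.congr hold).insert (a := c) (by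
    rw [Set.mem_Icc, hnew, ← card_removeCorner hc]
    omega)
  have hentries : insert μ.card (Set.Icc 1 (removeCorner μ c).card) = Set.Icc 1 μ.card := by
    ext k
    simp only [Set.mem_insert_iff, Set.mem_Icc, ← card_removeCorner hc]
    omega
  rwa [hnew, hentries, ← Finset.coe_insert, insert_cells_removeCorner hc] at hbij

theorem IsStandardTableau.le_card {T : SemistandardYoungTableau μ} (hT : IsStandardTableau T)
    (i j : ℕ) : T i j ≤ μ.card := by
  by_cases h : (i, j) ∈ μ
  · exact (hT.mapsTo h).2
  · exact (T.zeros h).trans_le (Nat.zero_le _)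

/-- Standard tableaux with largest entry at the corner `c` correspond to standard tableaux of the
diagram without `c`. -/
def standardTableauxCornerEquiv (hc : Maximal (· ∈ μ) c) :
    {T : {T : SemistandardYoungTableau μ // IsStandardTableau T} // T.1 c.1 c.2 = μ.card} ≃
      {T : SemistandardYoungTableau (removeCorner μ c) // IsStandardTableau T} where
  toFun T :=
    have h : removeCorner μ c ≤ μ := fun _ hx => ((mem_removeCorner hc).1 hx).2
    ⟨restrictTableau T.1.1 h, T.1.2.restrict hc T.2 h⟩
  invFun T :=
    have hN : ∀ i j, T.1 i j < μ.card := fun i j =>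
      (T.2.le_card i j).trans_lt (Nat.lt_of_succ_le (card_removeCorner hc).le)
    ⟨⟨extendTableau hc T.1 hN, T.2.extend hc hN⟩, if_pos rfl⟩
  left_inv T := by
    refine Subtype.ext (Subtype.ext (SemistandardYoungTableau.ext fun i j => ?_))
    rw [extendTableau_apply, restrictTableau_apply]
    split_ifs with h h'
    · subst h
      exact T.2.symm
    · rfl
    · exact (T.1.1.zeros fun hμ => h' ((mem_removeCorner hc).2 ⟨h, hμ⟩)).symm
  right_inv T := by
    refine Subtype.ext (SemistandardYoungTableau.ext fun i j => ?_)
    rw [restrictTableau_apply, extendTableau_apply]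
    split_ifs with h h'
    · exact absurd h' ((mem_removeCorner hc).1 h).1
    · rfl
    · exact (T.1.zeros h).symm

theorem IsStandardTableau.existsUnique_row {T : SemistandardYoungTableau μ}
    (hT : IsStandardTableau T) {d : ℕ} (hμ : 0 < μ.card) (hd : μ.colLen 0 ≤ d) :
    ∃! i : Fin d, μ.rowLen (i + 1) < μ.rowLen i ∧ T i (μ.rowLen i - 1) = μ.card := by
  obtain ⟨⟨i, j⟩, hij, hTij⟩ := hT.surjOn (show μ.card ∈ Set.Icc 1 μ.card from ⟨hμ, le_rfl⟩)
  have hid : i < d :=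
    (YoungDiagram.mem_iff_lt_colLen.1 (μ.up_left_mem le_rfl j.zero_le hij)).trans_le hd
  obtain ⟨hi, rfl⟩ := maximal_mem_youngDiagram_iff.1 (hT.maximal hij hTij)
  refine ⟨⟨i, hid⟩, ⟨hi, hTij⟩, fun k ⟨hk, hTk⟩ => Fin.ext ?_⟩
  have hkμ := (maximal_mem_youngDiagram_iff.2 ⟨hk, rfl⟩).prop
  exact congrArg Prod.fst (hT.injOn hkμ hij (hTk.trans hTij.symm))

theorem numStandardTableaux_eq_sum {d : ℕ} (hμ : 0 < μ.card) (hd : μ.colLen 0 ≤ d) :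
    numStandardTableaux μ = ∑ i ∈ {i : Fin d | μ.rowLen (i + 1) < μ.rowLen i},
      numStandardTableaux (removeCorner μ (i, μ.rowLen i - 1)) := by
  choose row hrow hrow_unique using
    fun T : {T : SemistandardYoungTableau μ // IsStandardTableau T} =>
      T.2.existsUnique_row hμ hd
  rw [numStandardTableaux, ← Nat.card_congr (Equiv.sigmaFiberEquiv row), Nat.card_sigma,
    Finset.sum_filter]
  refine Finset.sum_congr rfl fun i _ => ?_
  split_ifs with hi
  · have hfiber : ∀ T, row T = i ↔ T.1 i (μ.rowLen i - 1) = μ.card := fun T =>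
      ⟨fun h => h ▸ (hrow T).2, fun h => (hrow_unique T i ⟨hi, h⟩).symm⟩
    exact Nat.card_congr ((Equiv.subtypeEquivRight hfiber).trans
      (standardTableauxCornerEquiv (maximal_mem_youngDiagram_iff.2 ⟨hi, rfl⟩)))
  · have : IsEmpty {T // row T = i} := ⟨fun T => hi (T.2 ▸ (hrow T.1).1)⟩
    exact Nat.card_of_isEmpty

end BranchingRule

section Vandermonde

variable {R : Type*} [CommRing R]

theorem sum_det_updateCol_add_mul {ι : Type*} [Fintype ι] [DecidableEq ι] (M : Matrix ι ι R)
    (a b : ι → R) :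
    ∑ i, (M.updateCol i fun j => (a i + b j) * M j i).det = (∑ i, a i + ∑ j, b j) * M.det := by
  simp only [Matrix.det_apply]
  rw [Finset.sum_comm, Finset.mul_sum]
  refine Finset.sum_congr rfl fun σ _ => ?_
  rw [← Finset.smul_sum, mul_smul_comm, ← Equiv.sum_comp σ b, ← Finset.sum_add_distrib,
    Finset.sum_mul]
  congr 1
  refine Finset.sum_congr rfl fun i _ => ?_
  rw [← Finset.mul_prod_erase _ _ (Finset.mem_univ i),
    ← Finset.mul_prod_erase Finset.univ (fun k => M (σ k) k) (Finset.mem_univ i),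
    Matrix.updateCol_self, mul_assoc]
  congr 2
  exact Finset.prod_congr rfl fun k hk => by rw [Matrix.updateCol_ne (Finset.ne_of_mem_erase hk)]

variable {d : ℕ}

/-- The product of the differences `v i - v j`, `i < j`. -/
def diffProd (v : Fin d → R) : R :=
  ∏ i, ∏ j ∈ Finset.Ioi i, (v i - v j)

theorem diffProd_eq_det_vandermonde (v : Fin d → R) :
    diffProd v = (Matrix.vandermonde (-v)).det := by
  simp only [Matrix.det_vandermonde, diffProd, Pi.neg_apply, neg_sub_neg]

theorem diffProd_eq_zero_of_eq {v : Fin d → R} {i j : Fin d} (hij : i < j) (h : v i = v j) :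
    diffProd v = 0 :=
  Finset.prod_eq_zero (Finset.mem_univ i)
    (Finset.prod_eq_zero (Finset.mem_Ioi.2 hij) (sub_eq_zero.2 h))

theorem det_ascPochhammer_eval [Nontrivial R] [NoZeroDivisors R] (w : Fin d → R) :
    (Matrix.of fun j i : Fin d => (ascPochhammer R j).eval (w i)).det =
      (Matrix.vandermonde w).det := by
  rw [Matrix.det_eval_matrixOfPolynomials_eq_det_vandermonde w (fun j => ascPochhammer R j)
    (fun j => ascPochhammer_natDegree R j) (fun j => monic_ascPochhammer R j),
    ← Matrix.det_transpose]
  rfl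

theorem mul_ascPochhammer_eval_add_one (k : ℕ) (x : R) :
    x * (ascPochhammer R k).eval (x + 1) = (x + k) * (ascPochhammer R k).eval x := by
  rw [mul_comm (x + _), ← ascPochhammer_succ_eval, ascPochhammer_succ_left]
  simp

theorem sum_mul_det_vandermonde_update [Nontrivial R] [NoZeroDivisors R] (w : Fin d → R) :
    ∑ i, w i * (Matrix.vandermonde (Function.update w i (w i + 1))).det =
      (∑ i, w i + ∑ j : Fin d, (j : R)) * (Matrix.vandermonde w).det := by
  rw [← det_ascPochhammer_eval w, ← sum_det_updateCol_add_mul]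
  refine Finset.sum_congr rfl fun i _ => ?_
  have hcol : (Matrix.of fun j k : Fin d =>
      (ascPochhammer R j).eval (Function.update w i (w i + 1) k)) =
        (Matrix.of fun j k : Fin d => (ascPochhammer R j).eval (w k)).updateCol i
          fun j => (ascPochhammer R j).eval (w i + 1) := by
    ext j k
    by_cases h : k = i
    · subst h
      simp
    · simp [h]
  rw [← det_ascPochhammer_eval, hcol, ← Matrix.det_updateCol_smul]
  simp only [Pi.smul_def, smul_eq_mul, mul_ascPochhammer_eval_add_one, Matrix.of_apply]

theorem sum_mul_diffProd_update [Nontrivial R] [NoZeroDivisors R] (v : Fin d → R) :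
    ∑ i, v i * diffProd (Function.update v i (v i - 1)) =
      (∑ i, v i - ∑ j : Fin d, (j : R)) * diffProd v := by
  have hneg : ∀ i, -Function.update v i (v i - 1) = Function.update (-v) i ((-v) i + 1) :=
    fun i => by
      funext k
      by_cases h : k = i
      · subst h
        simp [sub_eq_neg_add]
      · simp [h]
  have h := sum_mul_det_vandermonde_update (-v)
  simp only [diffProd_eq_det_vandermonde, hneg]
  simp only [Pi.neg_apply, neg_mul, Finset.sum_neg_distrib] at h ⊢
  linear_combination -h

theorem diffProd_staircase (d : ℕ) :
    diffProd (fun i : Fin d => ((d - 1 - i : ℕ) : R)) =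
      ∏ i : Fin d, ((d - 1 - i : ℕ).factorial : R) := by
  rcases d with _ | d
  · simp [diffProd]
  have hneg : (-fun i : Fin (d + 1) => ((d + 1 - 1 - i : ℕ) : R)) =
      fun i : Fin (d + 1) => (i : R) - d := by
    funext i
    rw [Pi.neg_apply, Nat.add_sub_cancel, Nat.cast_sub (Nat.le_of_lt_succ i.2), neg_sub]
  rw [diffProd_eq_det_vandermonde, hneg, Matrix.det_vandermonde_sub,
    Matrix.det_vandermonde_id_eq_superFactorial, ← Nat.prod_range_succ_factorial,
    Nat.cast_prod, ← Finset.prod_range_reflect, Finset.prod_range]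

end Vandermonde

section FrobeniusYoung

variable {d : ℕ} {μ : YoungDiagram}

/-- The shifted row lengths `λ_i + d - i` (with `i` counted from `1`). -/
def shiftedRowLen (d : ℕ) (μ : YoungDiagram) (i : Fin d) : ℕ :=
  μ.rowLen i + (d - 1 - i)

theorem sum_shiftedRowLen (hd : μ.colLen 0 ≤ d) :
    ∑ i, shiftedRowLen d μ i = μ.card + ∑ j : Fin d, (j : ℕ) := by
  simp only [shiftedRowLen]
  rw [Finset.sum_add_distrib, ← card_eq_sum_rowLen hd, ← Finset.sum_range (fun i => d - 1 - i),
    Finset.sum_range_reflect (fun i => i), Finset.sum_range]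

theorem shiftedRowLen_pos {i : Fin d} (hi : μ.rowLen (i + 1) < μ.rowLen i) :
    0 < shiftedRowLen d μ i :=
  Nat.add_pos_left (Nat.zero_lt_of_lt hi) _

theorem shiftedRowLen_removeCorner {i : Fin d} (hi : μ.rowLen (i + 1) < μ.rowLen i) :
    shiftedRowLen d (removeCorner μ (i, μ.rowLen i - 1)) =
      Function.update (shiftedRowLen d μ) i (shiftedRowLen d μ i - 1) := by
  funext k
  rw [shiftedRowLen, rowLen_removeCorner hi, Function.update_apply]
  simp only [Fin.val_inj, shiftedRowLen]
  split_ifs with h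
  · subst h
    omega
  · rfl

theorem cast_shiftedRowLen_removeCorner {i : Fin d} (hi : μ.rowLen (i + 1) < μ.rowLen i) :
    (fun k => (shiftedRowLen d (removeCorner μ (i, μ.rowLen i - 1)) k : ℝ)) =
      Function.update (fun k => (shiftedRowLen d μ k : ℝ)) i (shiftedRowLen d μ i - 1) := by
  funext k
  rw [shiftedRowLen_removeCorner hi, Function.apply_update (fun _ (l : ℕ) => (l : ℝ)),
    Nat.cast_pred (shiftedRowLen_pos hi)]

theorem colLen_zero_removeCorner_le {i : ℕ} (hi : μ.rowLen (i + 1) < μ.rowLen i)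
    (hd : μ.colLen 0 ≤ d) : (removeCorner μ (i, μ.rowLen i - 1)).colLen 0 ≤ d := by
  rw [colLen_zero_le_iff_rowLen_eq_zero] at hd ⊢
  rw [rowLen_removeCorner hi]
  split_ifs <;> omega

theorem mul_diffProd_update_shiftedRowLen_eq_zero (hd : μ.colLen 0 ≤ d) {i : Fin d}
    (hi : ¬ μ.rowLen (i + 1) < μ.rowLen i) :
    (shiftedRowLen d μ i : ℝ) * diffProd (Function.update (fun k => (shiftedRowLen d μ k : ℝ)) i
      (shiftedRowLen d μ i - 1)) = 0 := by
  have hrow := μ.rowLen_anti i (i + 1) i.1.le_succ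
  by_cases hid : (i : ℕ) + 1 < d
  · have hlt : i < ⟨i + 1, hid⟩ := Fin.mk_lt_mk.2 i.1.lt_succ_self
    have hsucc : shiftedRowLen d μ i = shiftedRowLen d μ ⟨i + 1, hid⟩ + 1 := by
      simp only [shiftedRowLen]
      omega
    rw [diffProd_eq_zero_of_eq hlt, mul_zero]
    rw [Function.update_self, Function.update_of_ne hlt.ne', hsucc]
    simp
  · have hlast : (i : ℕ) + 1 = d := by omega
    rw [colLen_zero_le_iff_rowLen_eq_zero, ← hlast] at hd
    have hzero : shiftedRowLen d μ i = 0 := by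
      rw [shiftedRowLen]
      omega
    rw [hzero, Nat.cast_zero, zero_mul]

theorem numStandardTableaux_of_card_eq_zero (hμ : μ.card = 0) : numStandardTableaux μ = 1 := by
  have h : ∀ c, c ∉ μ := fun c hc =>
    Finset.notMem_empty c (Finset.card_eq_zero.1 hμ ▸ (YoungDiagram.mem_cells c).2 hc)
  rw [numStandardTableaux, Nat.card_eq_one_iff_unique]
  refine ⟨⟨fun T T' => Subtype.ext (SemistandardYoungTableau.ext fun i j => ?_)⟩,
    ⟨⟨default, fun c hc => absurd hc (h c), fun c hc => absurd hc (h c), fun k hk => ?_⟩⟩⟩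
  · rw [T.1.zeros (h _), T'.1.zeros (h _)]
  · exact absurd (hk.1.trans hk.2) (by omega)

theorem shiftedRowLen_of_card_eq_zero (hd : μ.colLen 0 ≤ d) (hμ : μ.card = 0) (i : Fin d) :
    shiftedRowLen d μ i = d - 1 - i := by
  have h := Finset.sum_eq_zero_iff.1 ((card_eq_sum_rowLen hd).symm.trans hμ) i (Finset.mem_univ i)
  rw [shiftedRowLen, h, zero_add]

theorem mul_prod_factorial_update_pred {ι : Type*} [Fintype ι] [DecidableEq ι] (l : ι → ℕ) {i : ι}
    (hi : 0 < l i) :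
    l i * ∏ j, (Function.update l i (l i - 1) j).factorial = ∏ j, (l j).factorial := by
  rw [← Finset.mul_prod_erase _ _ (Finset.mem_univ i),
    ← Finset.mul_prod_erase Finset.univ (fun j => (l j).factorial) (Finset.mem_univ i),
    ← mul_assoc, Function.update_self, Nat.mul_factorial_pred hi.ne']
  congr 1
  exact Finset.prod_congr rfl fun j hj => by rw [Function.update_of_ne (Finset.ne_of_mem_erase hj)]

/-- The formula of Frobenius and Young, equivalent to the hook length formula. -/
theorem numStandardTableaux_mul_prod_factorial (μ : YoungDiagram) (hd : μ.colLen 0 ≤ d) :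
    (numStandardTableaux μ : ℝ) * ∏ i, ((shiftedRowLen d μ i).factorial : ℝ) =
      μ.card.factorial * diffProd (fun i => (shiftedRowLen d μ i : ℝ)) := by
  induction hN : μ.card generalizing μ with
  | zero =>
    simp only [shiftedRowLen_of_card_eq_zero hd hN, numStandardTableaux_of_card_eq_zero hN,
      diffProd_staircase, Nat.factorial_zero]
  | succ N ih =>
    set l := shiftedRowLen d μ
    set D : Fin d → ℝ := fun i => diffProd (Function.update (fun k => (l k : ℝ)) i (l i - 1))
    have hremovable : ∀ i : Fin d, μ.rowLen (i + 1) < μ.rowLen i →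
        (numStandardTableaux (removeCorner μ (i, μ.rowLen i - 1)) : ℝ) *
          ∏ j, ((l j).factorial : ℝ) = N.factorial * (l i * D i) := fun i hi => by
      have hcard := card_removeCorner (maximal_mem_youngDiagram_iff.2 ⟨hi, rfl⟩)
      have hformula := ih _ (colLen_zero_removeCorner_le hi hd) (by omega)
      rw [cast_shiftedRowLen_removeCorner hi, shiftedRowLen_removeCorner hi] at hformula
      rw [← Nat.cast_prod, ← mul_prod_factorial_update_pred l (shiftedRowLen_pos hi), Nat.cast_mul,
        Nat.cast_prod, mul_left_comm, hformula, mul_left_comm]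
    calc (numStandardTableaux μ : ℝ) * ∏ i, ((l i).factorial : ℝ)
        = ∑ i ∈ {i : Fin d | μ.rowLen (i + 1) < μ.rowLen i}, N.factorial * (l i * D i) := by
          rw [numStandardTableaux_eq_sum (by omega) hd, Nat.cast_sum, Finset.sum_mul]
          exact Finset.sum_congr rfl fun i hi => hremovable i (Finset.mem_filter.1 hi).2
      _ = ∑ i, N.factorial * (l i * D i) := by
          refine Finset.sum_filter_of_ne fun i _ => not_imp_comm.1 fun hi => ?_
          rw [mul_diffProd_update_shiftedRowLen_eq_zero hd hi, mul_zero]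
      _ = N.factorial * ((∑ i, (l i : ℝ) - ∑ j : Fin d, (j : ℝ)) *
            diffProd (fun i => (l i : ℝ))) := by
          rw [← Finset.mul_sum, sum_mul_diffProd_update]
      _ = (N + 1).factorial * diffProd (fun i => (l i : ℝ)) := by
          have hsum : ∑ i, (l i : ℝ) = N + 1 + ∑ j : Fin d, (j : ℝ) := by
            exact_mod_cast hN ▸ sum_shiftedRowLen hd
          rw [hsum, add_sub_cancel_right, Nat.factorial_succ]
          push_cast
          ring

end FrobeniusYoung

section Poisson

/-- The Poisson weight `e^{-a} a^l / l!`. The mean `a` is of type `ℝ`, not `ℝ≥0` as for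
`ProbabilityTheory.poissonMeasure`, so that no coercions arise in the asymptotics. -/
noncomputable def poissonWeight (a : ℝ) (l : ℕ) : ℝ :=
  Real.exp (-a) * a ^ l / l.factorial

theorem poissonWeight_nonneg {a : ℝ} (ha : 0 ≤ a) (l : ℕ) : 0 ≤ poissonWeight a l := by
  unfold poissonWeight
  positivity

theorem poissonWeight_le_one {a : ℝ} (ha : 0 ≤ a) (l : ℕ) : poissonWeight a l ≤ 1 := by
  rw [poissonWeight, mul_div_assoc, Real.exp_neg, inv_mul_le_one₀ (Real.exp_pos a)]
  exact Real.pow_div_factorial_le_exp a ha l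

theorem mul_poissonWeight_succ (a : ℝ) (l : ℕ) :
    (l + 1) * poissonWeight a (l + 1) = a * poissonWeight a l := by
  rw [poissonWeight, poissonWeight, Nat.factorial_succ, pow_succ]
  push_cast
  field_simp

theorem poissonWeight_monotoneOn {a : ℝ} (ha : 0 ≤ a) :
    MonotoneOn (poissonWeight a) (Set.Iic ⌊a⌋₊) := by
  refine monotoneOn_of_le_add_one Set.ordConnected_Iic fun l _ _ hl => ?_
  have hla : (l : ℝ) + 1 ≤ a := by exact_mod_cast (Nat.le_floor_iff ha).1 hl
  refine le_of_mul_le_mul_left ?_ (by positivity : (0 : ℝ) < l + 1)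
  rw [mul_poissonWeight_succ]
  exact mul_le_mul_of_nonneg_right hla (poissonWeight_nonneg ha l)

theorem sqrt_mul_poissonWeight_eq {a : ℝ} (ha : 0 < a) {l : ℕ} (hl : l ≠ 0) :
    √(2 * Real.pi * a) * poissonWeight a l = √Real.pi / Stirling.stirlingSeq l * √(a / l) *
      Real.exp (-(a * InformationTheory.klFun (l / a))) := by
  have hl' : (0 : ℝ) < l := by positivity
  have hpow : Real.exp (-(a * InformationTheory.klFun (l / a))) =
      Real.exp (-a) * a ^ l / (l / Real.exp 1) ^ l := by
    have hexponent : -(a * InformationTheory.klFun (l / a)) =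
        -a + l * (Real.log a - (Real.log l - 1)) := by
      rw [InformationTheory.klFun, Real.log_div hl'.ne' ha.ne']
      field_simp
      ring
    rw [hexponent, Real.exp_add, Real.exp_nat_mul, Real.exp_sub, Real.exp_sub, Real.exp_log ha,
      Real.exp_log hl', div_pow, mul_div_assoc]
  have hsqrt : √(2 * Real.pi * a) = √Real.pi * √(2 * l) * √(a / l) := by
    rw [← Real.sqrt_mul Real.pi_pos.le, ← Real.sqrt_mul (by positivity)]
    congr 1
    field_simp
  rw [hpow, hsqrt, Stirling.stirlingSeq, poissonWeight]
  field_simp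

theorem sqrt_mul_poissonWeight_le_sqrt_div {a : ℝ} (ha : 0 < a) {l : ℕ} (hl : l ≠ 0) :
    √(2 * Real.pi * a) * poissonWeight a l ≤ √(a / l) := by
  rw [sqrt_mul_poissonWeight_eq ha hl]
  have hstirling := Stirling.sqrt_pi_le_stirlingSeq hl
  have hratio : √Real.pi / Stirling.stirlingSeq l ≤ 1 :=
    div_le_one_of_le₀ hstirling ((Real.sqrt_nonneg _).trans hstirling)
  have hexp : Real.exp (-(a * InformationTheory.klFun (l / a))) ≤ 1 :=
    Real.exp_le_one_iff.2 (neg_nonpos.2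
      (mul_nonneg ha.le (InformationTheory.klFun_nonneg (by positivity))))
  calc _ ≤ 1 * √(a / l) * 1 := by gcongr
    _ = √(a / l) := by rw [one_mul, mul_one]

theorem sqrt_mul_poissonWeight_le_one {a : ℝ} (ha : 0 ≤ a) (l : ℕ) :
    √a * poissonWeight a l ≤ 1 := by
  rcases lt_or_ge a 1 with h1 | h1
  · exact mul_le_one₀ (Real.sqrt_le_one.2 h1.le) (poissonWeight_nonneg ha l)
      (poissonWeight_le_one ha l)
  have ha0 : 0 < a := one_pos.trans_le h1
  have hlarge : ∀ k : ℕ, ⌊a⌋₊ ≤ k → √a * poissonWeight a k ≤ 1 := fun k hk => by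
    have hk0 : 0 < k := (Nat.floor_pos.2 h1).trans_le hk
    have hk0' : (0 : ℝ) < k := by exact_mod_cast hk0
    have hak : a / k ≤ 2 * Real.pi := by
      rw [div_le_iff₀ hk0']
      have hfloor : a < k + 1 := (Nat.lt_floor_add_one a).trans_le (by gcongr)
      have hk1 : (1 : ℝ) ≤ k := by exact_mod_cast hk0
      nlinarith [Real.pi_gt_three]
    have h := sqrt_mul_poissonWeight_le_sqrt_div ha0 hk0.ne'
    rw [Real.sqrt_mul (by positivity), mul_assoc] at h
    refine le_of_mul_le_mul_left ?_ (by positivity : 0 < √(2 * Real.pi))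
    exact h.trans ((Real.sqrt_le_sqrt hak).trans_eq (mul_one _).symm)
  rcases le_total ⌊a⌋₊ l with h | h
  · exact hlarge l h
  · exact (mul_le_mul_of_nonneg_left (poissonWeight_monotoneOn ha h Set.self_mem_Iic h)
      (Real.sqrt_nonneg a)).trans (hlarge _ le_rfl)

theorem poissonWeight_mul_exp (a s : ℝ) (l : ℕ) :
    poissonWeight a l * Real.exp (s * (l - a)) =
      poissonWeight (a * Real.exp s) l * Real.exp (a * (Real.exp s - 1 - s)) := by
  have hexp : Real.exp (-a) * Real.exp (s * (l - a)) =
      Real.exp (-(a * Real.exp s)) * Real.exp (l * s) * Real.exp (a * (Real.exp s - 1 - s)) := by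
    simp only [← Real.exp_add]
    congr 1
    ring
  rw [poissonWeight, poissonWeight, mul_pow, ← Real.exp_nat_mul]
  linear_combination a ^ l / l.factorial * hexp

theorem sqrt_mul_poissonWeight_mul_exp_le {a s : ℝ} (ha : 0 ≤ a) (hs : |s| ≤ 1)
    (has : a * s ^ 2 ≤ 1) (l : ℕ) :
    √a * (poissonWeight a l * Real.exp (s * (l - a))) ≤ Real.exp 2 := by
  have hexponent : a * (Real.exp s - 1 - s) ≤ 1 :=
    (mul_le_mul_of_nonneg_left (abs_le.1 (Real.abs_exp_sub_one_sub_id_le hs)).2 ha).trans has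
  have hsqrt : √a ≤ Real.exp 1 * √(a * Real.exp s) := by
    refine Real.sqrt_le_iff.2 ⟨by positivity, ?_⟩
    rw [mul_pow, Real.sq_sqrt (by positivity), mul_left_comm, ← Real.exp_nat_mul, ← Real.exp_add]
    refine le_mul_of_one_le_right ha (Real.one_le_exp ?_)
    have := (abs_le.1 hs).1
    push_cast
    linarith
  have hnonneg := poissonWeight_nonneg (a := a * Real.exp s) (by positivity) l
  calc √a * (poissonWeight a l * Real.exp (s * (l - a)))
      = √a * poissonWeight (a * Real.exp s) l * Real.exp (a * (Real.exp s - 1 - s)) := by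
        rw [poissonWeight_mul_exp, mul_assoc]
    _ ≤ (Real.exp 1 * √(a * Real.exp s)) * poissonWeight (a * Real.exp s) l * Real.exp 1 := by
        gcongr
    _ = Real.exp 2 * (√(a * Real.exp s) * poissonWeight (a * Real.exp s) l) := by
        rw [← one_add_one_eq_two, Real.exp_add]
        ring
    _ ≤ Real.exp 2 :=
        mul_le_of_le_one_right (Real.exp_pos 2).le (sqrt_mul_poissonWeight_le_one (by positivity) l)

theorem sqrt_mul_poissonWeight_le_exp {a : ℝ} (ha : 1 ≤ a) (l : ℕ) :
    √a * poissonWeight a l ≤ Real.exp 2 * Real.exp (-|(l - a) / √a|) := by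
  have ha0 : 0 ≤ a := zero_le_one.trans ha
  have hsq : 1 ≤ √a := Real.one_le_sqrt.2 ha
  obtain ⟨ε, hε, hεl⟩ : ∃ ε : ℝ, |ε| = 1 ∧ ε * (l - a) = |l - a| := by
    rcases le_total 0 ((l : ℝ) - a) with h | h
    · exact ⟨1, abs_one, by rw [one_mul, abs_of_nonneg h]⟩
    · exact ⟨-1, by rw [abs_neg, abs_one], by rw [neg_one_mul, abs_of_nonpos h]⟩
  have hs : |ε / √a| ≤ 1 := by
    rw [abs_div, hε, abs_of_nonneg (Real.sqrt_nonneg a)]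
    exact div_le_one_of_le₀ hsq (Real.sqrt_nonneg a)
  have has : a * (ε / √a) ^ 2 ≤ 1 := by
    rw [div_pow, ← sq_abs ε, hε, Real.sq_sqrt ha0, one_pow, mul_one_div]
    exact div_self_le_one a
  have h := sqrt_mul_poissonWeight_mul_exp_le ha0 hs has l
  rw [div_mul_eq_mul_div, hεl, ← mul_assoc] at h
  rwa [Real.exp_neg, ← div_eq_mul_inv, le_div_iff₀ (Real.exp_pos _), abs_div,
    abs_of_nonneg (Real.sqrt_nonneg a)]

theorem abs_klFun_sub_le {x : ℝ} (hx : |x - 1| ≤ 1 / 2) :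
    |InformationTheory.klFun x - (x - 1) ^ 2 / 2| ≤ 5 * |x - 1| ^ 3 := by
  obtain ⟨y, rfl⟩ : ∃ y, x = 1 + y := ⟨x - 1, by ring⟩
  rw [add_sub_cancel_left] at hx ⊢
  have hlog := Real.abs_log_sub_add_sum_range_le (x := -y) (by rw [abs_neg]; linarith) 2
  simp only [Finset.sum_range_succ, Finset.sum_range_zero, abs_neg, sub_neg_eq_add] at hlog
  norm_num at hlog
  set r := -y + y ^ 2 / 2 + Real.log (1 + y) with hr
  have hr_le : |r| ≤ 2 * |y| ^ 3 := by
    refine hlog.trans ?_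
    rw [div_le_iff₀ (by linarith)]
    nlinarith [pow_nonneg (abs_nonneg y) 3]
  have hy_le : |1 + y| ≤ 2 := (abs_add_le 1 y).trans (by rw [abs_one]; linarith)
  calc |InformationTheory.klFun (1 + y) - y ^ 2 / 2| = |-(y ^ 3 / 2) + (1 + y) * r| := by
        rw [InformationTheory.klFun, hr]
        congr 1
        ring
    _ ≤ |y| ^ 3 / 2 + |1 + y| * |r| := by
        refine (abs_add_le _ _).trans_eq ?_
        rw [abs_neg, abs_div, abs_pow, abs_mul, abs_two]
    _ ≤ |y| ^ 3 / 2 + 2 * (2 * |y| ^ 3) := by gcongr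
    _ ≤ 5 * |y| ^ 3 := by nlinarith [pow_nonneg (abs_nonneg y) 3]

variable {ι : Type*} {f : Filter ι} {a : ι → ℝ} {t : ℝ}

theorem tendsto_one_of_tendsto_sqrt_mul_sub {x : ι → ℝ} (ha : Tendsto a f atTop)
    (hx : Tendsto (fun n => √(a n) * (x n - 1)) f (𝓝 t)) : Tendsto x f (𝓝 1) := by
  have h := (hx.div_atTop (Real.tendsto_sqrt_atTop.comp ha)).add_const 1
  rw [zero_add] at h
  refine h.congr' ?_
  filter_upwards [ha.eventually_gt_atTop 0] with n hn
  rw [Function.comp_apply, mul_div_cancel_left₀ _ (Real.sqrt_ne_zero'.2 hn), sub_add_cancel]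

theorem tendsto_mul_klFun {x : ι → ℝ} (ha : Tendsto a f atTop)
    (hx : Tendsto (fun n => √(a n) * (x n - 1)) f (𝓝 t)) :
    Tendsto (fun n => a n * InformationTheory.klFun (x n)) f (𝓝 (t ^ 2 / 2)) := by
  have hx0 : Tendsto (fun n => |x n - 1|) f (𝓝 0) := by
    simpa using ((tendsto_one_of_tendsto_sqrt_mul_sub ha hx).sub_const 1).abs
  have hsq : Tendsto (fun n => a n * (x n - 1) ^ 2) f (𝓝 (t ^ 2)) := by
    refine (hx.pow 2).congr' ?_
    filter_upwards [ha.eventually_ge_atTop 0] with n hn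
    rw [mul_pow, Real.sq_sqrt hn]
  have herr : Tendsto (fun n => a n * (InformationTheory.klFun (x n) - (x n - 1) ^ 2 / 2)) f
      (𝓝 0) := by
    have hbound : Tendsto (fun n => 5 * (a n * (x n - 1) ^ 2 * |x n - 1|)) f (𝓝 0) := by
      simpa using (hsq.mul hx0).const_mul 5
    refine squeeze_zero_norm' ?_ hbound
    filter_upwards [ha.eventually_ge_atTop 0, hx0.eventually_le_const one_half_pos] with n hn hxn
    calc ‖a n * (InformationTheory.klFun (x n) - (x n - 1) ^ 2 / 2)‖
        = a n * |InformationTheory.klFun (x n) - (x n - 1) ^ 2 / 2| := by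
          rw [Real.norm_eq_abs, abs_mul, abs_of_nonneg hn]
      _ ≤ a n * (5 * |x n - 1| ^ 3) := by
          gcongr
          exact abs_klFun_sub_le hxn
      _ = 5 * (a n * (x n - 1) ^ 2 * |x n - 1|) := by
          rw [← sq_abs]
          ring
  have h := herr.add (hsq.div_const 2)
  rw [zero_add] at h
  exact h.congr fun n => by ring

/-- The local limit theorem for the Poisson distribution. -/
theorem tendsto_sqrt_mul_poissonWeight {l : ι → ℕ} (ha : Tendsto a f atTop)
    (hl : Tendsto (fun n => (l n - a n) / √(a n)) f (𝓝 t)) :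
    Tendsto (fun n => √(2 * Real.pi * a n) * poissonWeight (a n) (l n)) f
      (𝓝 (Real.exp (-(t ^ 2 / 2)))) := by
  have hapos : ∀ᶠ n in f, 0 < a n := ha.eventually_gt_atTop 0
  have hdev : Tendsto (fun n => √(a n) * (l n / a n - 1)) f (𝓝 t) := by
    refine hl.congr' ?_
    filter_upwards [hapos] with n hn
    rw [div_sub_one hn.ne', mul_div_left_comm, Real.sqrt_div_self', mul_one_div]
  have hratio : Tendsto (fun n => l n / a n) f (𝓝 1) := tendsto_one_of_tendsto_sqrt_mul_sub ha hdev
  have hl_atTop : Tendsto l f atTop := by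
    refine tendsto_natCast_atTop_iff.1 ((hratio.pos_mul_atTop one_pos ha).congr' ?_)
    filter_upwards [hapos] with n hn
    exact div_mul_cancel₀ _ hn.ne'
  have hstirling : Tendsto (fun n => √Real.pi / Stirling.stirlingSeq (l n)) f (𝓝 1) := by
    have hpi := Real.sqrt_ne_zero'.2 Real.pi_pos
    rw [← div_self hpi]
    exact tendsto_const_nhds.div (Stirling.tendsto_stirlingSeq_sqrt_pi.comp hl_atTop) hpi
  have hsqrt : Tendsto (fun n => √(a n / l n)) f (𝓝 1) := by
    have h := (hratio.inv₀ one_ne_zero).sqrt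
    rw [inv_one, Real.sqrt_one] at h
    exact h.congr fun n => by rw [inv_div]
  have hexp := (Real.continuous_exp.tendsto _).comp (tendsto_mul_klFun ha hdev).neg
  have h := (hstirling.mul hsqrt).mul hexp
  rw [one_mul, one_mul] at h
  refine h.congr' ?_
  filter_upwards [hapos, hl_atTop.eventually_ne_atTop 0] with n hn hln
  exact (sqrt_mul_poissonWeight_eq hn hln).symm

end Poisson

section Normalization

theorem sum_fin_val (d : ℕ) : ∑ j : Fin d, (j : ℕ) = d.choose 2 := by
  rw [← Finset.sum_range (fun j => j), Finset.sum_range_id, Nat.choose_two_right]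

theorem sum_card_Ioi_fin (d : ℕ) : ∑ i : Fin d, (Finset.Ioi i).card = d.choose 2 := by
  simp only [Fin.card_Ioi]
  rw [← sum_fin_val, ← Finset.sum_range (fun i => d - 1 - i),
    Finset.sum_range_reflect (fun i => i), Finset.sum_range]

theorem diffProd_sub_div {K : Type*} [Field K] {d : ℕ} (v : Fin d → K) (a r : K) :
    diffProd (fun i => (v i - a) / r) = diffProd v / r ^ d.choose 2 := by
  rw [← sum_card_Ioi_fin, ← Finset.prod_pow_eq_pow_sum, diffProd, diffProd,
    ← Finset.prod_div_distrib]
  refine Finset.prod_congr rfl fun i _ => ?_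
  rw [← Finset.prod_const, ← Finset.prod_div_distrib]
  exact Finset.prod_congr rfl fun j _ => by rw [← sub_div, sub_sub_sub_cancel_right]

theorem abs_diffProd_le {d : ℕ} (v : Fin d → ℝ) :
    |diffProd v| ≤ (2 * ∑ i, |v i|) ^ d.choose 2 := by
  have hle : ∀ i, |v i| ≤ ∑ i, |v i| := fun i =>
    Finset.single_le_sum (f := fun i => |v i|) (fun i _ => abs_nonneg _) (Finset.mem_univ i)
  rw [← sum_card_Ioi_fin, ← Finset.prod_pow_eq_pow_sum, diffProd, Finset.abs_prod]
  refine Finset.prod_le_prod (fun i _ => abs_nonneg _) fun i _ => ?_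
  rw [Finset.abs_prod, ← Finset.prod_const]
  refine Finset.prod_le_prod (fun i _ => abs_nonneg _) fun j _ => ?_
  linarith [abs_sub (v i) (v j), hle i, hle j]

theorem two_mul_pow_le_mul_exp_half {s : ℝ} (hs : 0 ≤ s) (c : ℕ) :
    (2 * s) ^ c ≤ 4 ^ c * c.factorial * Real.exp (s / 2) := by
  have h := Real.pow_div_factorial_le_exp (s / 2) (by positivity) c
  rw [div_le_iff₀' (by positivity)] at h
  calc (2 * s) ^ c = 4 ^ c * (s / 2) ^ c := by
        rw [← mul_pow]
        ring
    _ ≤ 4 ^ c * (c.factorial * Real.exp (s / 2)) := by gcongr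
    _ = 4 ^ c * c.factorial * Real.exp (s / 2) := (mul_assoc _ _ _).symm

/-- The rescaling `k ↦ (k - n / d) / √n` of row lengths: those of a typical partition of `n` into
at most `d` parts deviate from `n / d` by the order of `√n`. -/
noncomputable def rescale (d n : ℕ) (k : ℝ) : ℝ :=
  (k - n / d) / √n

/-- The growth rate `(2π)^{-(d-1)/2} d^{n+d²/2} n^{-(d-1)(d+2)/4}` of the number of standard
tableaux with `d` rows and `n` cells whose row lengths are `n / d + O(√n)`. -/
noncomputable def growthFactor (d n : ℕ) : ℝ :=
  (2 * Real.pi) ^ (-(((d : ℝ) - 1) / 2)) * (d : ℝ) ^ ((n : ℝ) + (d : ℝ) ^ 2 / 2) *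
    (n : ℝ) ^ (-(((d : ℝ) - 1) * ((d : ℝ) + 2) / 4))

/-- The number of standard tableaux with `n` cells and shifted row lengths `l`, divided by
`growthFactor d n`. -/
noncomputable def normalizedCount (d n : ℕ) (l : Fin d → ℕ) : ℝ :=
  Stirling.stirlingSeq n / √Real.pi * diffProd (fun i => rescale d n (l i)) *
    ∏ i, (√(2 * Real.pi * (n / d)) * poissonWeight (n / d) (l i))

variable {d n : ℕ}

theorem growthFactor_nonneg (d n : ℕ) : 0 ≤ growthFactor d n := by
  unfold growthFactor
  positivity

theorem growthFactor_mul (hd : 0 < d) (hn : 0 < n) :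
    growthFactor d n * (√(2 * Real.pi * (n / d)) ^ d * (n / d : ℝ) ^ d.choose 2) =
      √(2 * Real.pi * n) * d ^ n * √n ^ d.choose 2 := by
  have hd' : (0 : ℝ) < d := by positivity
  have hn' : (0 : ℝ) < n := by positivity
  have hpi : (0 : ℝ) < 2 * Real.pi := by positivity
  rw [growthFactor]
  refine Real.log_injOn_pos (Set.mem_Ioi.2 (by positivity)) (Set.mem_Ioi.2 (by positivity)) ?_
  rw [Real.log_mul (by positivity) (by positivity), Real.log_mul (by positivity) (by positivity),
    Real.log_mul (by positivity) (by positivity), Real.log_mul (by positivity) (by positivity),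
    Real.log_mul (by positivity) (by positivity), Real.log_mul (by positivity) (by positivity),
    Real.log_rpow hpi, Real.log_rpow hd', Real.log_rpow hn', Real.log_pow, Real.log_pow,
    Real.log_pow, Real.log_pow, Real.log_sqrt (by positivity), Real.log_sqrt (by positivity),
    Real.log_sqrt hn'.le, Real.log_mul hpi.ne' (by positivity), Real.log_mul hpi.ne' hn'.ne',
    Real.log_div hn'.ne' hd'.ne', Nat.cast_choose_two]
  ring

theorem prod_sqrt_mul_poissonWeight (hd : 0 < d) {l : Fin d → ℕ}
    (hl : ∑ i, l i = n + d.choose 2) :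
    ∏ i, (√(2 * Real.pi * (n / d)) * poissonWeight (n / d) (l i)) =
      √(2 * Real.pi * (n / d)) ^ d * (Real.exp (-n) * (n / d) ^ (n + d.choose 2)) /
        ∏ i, ((l i).factorial : ℝ) := by
  have hexp : Real.exp (-(n / d : ℝ)) ^ d = Real.exp (-n) := by
    rw [← Real.exp_nat_mul, mul_neg, mul_div_cancel₀ _ (by positivity)]
  simp only [poissonWeight]
  rw [Finset.prod_mul_distrib, Finset.prod_div_distrib, Finset.prod_mul_distrib,
    Finset.prod_pow_eq_pow_sum, hl, Finset.prod_const, Finset.prod_const, Finset.card_univ,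
    Fintype.card_fin, hexp]
  exact (mul_div_assoc _ _ _).symm

theorem factorial_eq_stirlingSeq_mul (hn : 0 < n) :
    (n.factorial : ℝ) =
      Stirling.stirlingSeq n / √Real.pi * (√(2 * Real.pi * n) * (Real.exp (-n) * n ^ n)) := by
  have hsqrt : √(2 * Real.pi * n) = √Real.pi * √(2 * n) := by
    rw [← Real.sqrt_mul Real.pi_pos.le]
    congr 1
    ring
  rw [Stirling.stirlingSeq, hsqrt, div_pow, ← Real.exp_nat_mul, mul_one, Real.exp_neg]
  field_simp

theorem numStandardTableaux_eq_growthFactor_mul (hd : 0 < d) (hn : 0 < n) {μ : YoungDiagram}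
    (hμ : μ.card = n) (hμd : μ.colLen 0 ≤ d) :
    (numStandardTableaux μ : ℝ) = growthFactor d n * normalizedCount d n (shiftedRowLen d μ) := by
  have hformula := numStandardTableaux_mul_prod_factorial μ hμd
  have hgrowth := growthFactor_mul hd hn
  have hsum : ∑ i, shiftedRowLen d μ i = n + d.choose 2 := by
    rw [sum_shiftedRowLen hμd, hμ, sum_fin_val]
  have hprod_ne : ∏ i, ((shiftedRowLen d μ i).factorial : ℝ) ≠ 0 :=
    Finset.prod_ne_zero_iff.2 fun i _ => by positivity
  rw [hμ, factorial_eq_stirlingSeq_mul hn, ← eq_div_iff hprod_ne] at hformula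
  simp only [hformula, normalizedCount, rescale]
  rw [diffProd_sub_div, prod_sqrt_mul_poissonWeight hd hsum, pow_add, div_pow (n : ℝ) d n]
  have hsqrt_ne : √n ^ d.choose 2 ≠ 0 := by positivity
  have hd_ne : (d : ℝ) ^ n ≠ 0 := by positivity
  set S := Stirling.stirlingSeq n / √Real.pi
  set D := diffProd fun i => (shiftedRowLen d μ i : ℝ)
  set A := √(2 * Real.pi * (n / d)) ^ d
  set B := (n / d : ℝ) ^ d.choose 2
  set F := ∏ i, ((shiftedRowLen d μ i).factorial : ℝ)
  set C := √n ^ d.choose 2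
  calc S * (√(2 * Real.pi * n) * (Real.exp (-n) * n ^ n)) * D / F
      = S * D * (√(2 * Real.pi * n) * d ^ n * C) * (Real.exp (-n) * n ^ n) /
          (d ^ n * C * F) := by field_simp
    _ = S * D * (growthFactor d n * (A * B)) * (Real.exp (-n) * n ^ n) /
          (d ^ n * C * F) := by rw [hgrowth]
    _ = growthFactor d n * (S * (D / C) * (A * (Real.exp (-n) * (n ^ n / d ^ n * B)) / F)) := by
        field_simp

theorem tendsto_stirlingSeq_div_sqrt_pi :
    Tendsto (fun n => Stirling.stirlingSeq n / √Real.pi) atTop (𝓝 1) := by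
  have h := Stirling.tendsto_stirlingSeq_sqrt_pi.div_const √Real.pi
  rwa [div_self (Real.sqrt_pos.2 Real.pi_pos).ne'] at h

theorem tendsto_normalizedCount (hd : 0 < d) {L : ℕ → Fin d → ℕ} {X : Fin d → ℝ}
    (hL : ∀ i, Tendsto (fun n => rescale d n (L n i)) atTop (𝓝 (X i))) :
    Tendsto (fun n => normalizedCount d n (L n)) atTop
      (𝓝 (Real.exp (-(d / 2 : ℝ) * ∑ i, X i ^ 2) * diffProd X)) := by
  have hmean : Tendsto (fun n : ℕ => (n / d : ℝ)) atTop atTop :=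
    tendsto_natCast_atTop_atTop.atTop_div_const (by positivity)
  have hdiffProd : Tendsto (fun n => diffProd fun i => rescale d n (L n i)) atTop
      (𝓝 (diffProd X)) :=
    tendsto_finsetProd _ fun i _ => tendsto_finsetProd _ fun j _ => (hL i).sub (hL j)
  have hweight : ∀ i, Tendsto (fun n : ℕ => √(2 * Real.pi * (n / d)) *
      poissonWeight (n / d) (L n i)) atTop (𝓝 (Real.exp (-(d / 2 : ℝ) * X i ^ 2))) := by
    intro i
    have hdev : Tendsto (fun n : ℕ => ((L n i : ℝ) - n / d) / √(n / d)) atTop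
        (𝓝 (√d * X i)) := by
      refine ((hL i).const_mul √d).congr fun n => ?_
      rw [rescale, Real.sqrt_div (Nat.cast_nonneg n)]
      field_simp
    have h := tendsto_sqrt_mul_poissonWeight hmean hdev
    rwa [mul_pow, Real.sq_sqrt (Nat.cast_nonneg d), mul_div_right_comm, ← neg_mul] at h
  have h := (tendsto_stirlingSeq_div_sqrt_pi.mul hdiffProd).mul
    (tendsto_finsetProd Finset.univ fun i _ => hweight i)
  rwa [← Real.exp_sum, ← Finset.mul_sum, one_mul, mul_comm (diffProd X)] at h

theorem sqrt_mul_poissonWeight_le_exp_abs_rescale (hd : 0 < d) (hn : d ≤ n) (l : ℕ) :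
    √(2 * Real.pi * (n / d)) * poissonWeight (n / d) l ≤
      √(2 * Real.pi) * Real.exp 2 * Real.exp (-|rescale d n l|) := by
  have hmean : (1 : ℝ) ≤ n / d := (one_le_div (by positivity)).2 (by exact_mod_cast hn)
  have hn0 : 0 < n := hd.trans_le hn
  have hdev : |rescale d n l| ≤ |((l : ℝ) - n / d) / √(n / d)| := by
    rw [rescale, abs_div, abs_div, abs_of_nonneg (Real.sqrt_nonneg _),
      abs_of_nonneg (Real.sqrt_nonneg _)]
    gcongr
    exact div_le_self (Nat.cast_nonneg n) (by exact_mod_cast hd)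
  calc √(2 * Real.pi * (n / d)) * poissonWeight (n / d) l
      = √(2 * Real.pi) * (√(n / d) * poissonWeight (n / d) l) := by
        rw [Real.sqrt_mul (by positivity), mul_assoc]
    _ ≤ √(2 * Real.pi) * (Real.exp 2 * Real.exp (-|((l : ℝ) - n / d) / √(n / d)|)) := by
        exact mul_le_mul_of_nonneg_left (sqrt_mul_poissonWeight_le_exp hmean l)
          (Real.sqrt_nonneg _)
    _ ≤ √(2 * Real.pi) * (Real.exp 2 * Real.exp (-|rescale d n l|)) := by gcongr
    _ = √(2 * Real.pi) * Real.exp 2 * Real.exp (-|rescale d n l|) := (mul_assoc _ _ _).symm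

theorem prod_sqrt_mul_poissonWeight_nonneg (d n : ℕ) (l : Fin d → ℕ) :
    0 ≤ ∏ i, (√(2 * Real.pi * (n / d)) * poissonWeight (n / d) (l i)) :=
  Finset.prod_nonneg fun i _ =>
    mul_nonneg (Real.sqrt_nonneg _) (poissonWeight_nonneg (by positivity) _)

theorem prod_sqrt_mul_poissonWeight_le (hd : 0 < d) (hn : d ≤ n) (l : Fin d → ℕ) :
    ∏ i, (√(2 * Real.pi * (n / d)) * poissonWeight (n / d) (l i)) ≤
      (√(2 * Real.pi) * Real.exp 2) ^ d * Real.exp (-∑ i, |rescale d n (l i)|) := by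
  refine (Finset.prod_le_prod (fun i _ => mul_nonneg (Real.sqrt_nonneg _)
    (poissonWeight_nonneg (by positivity) _)) fun i _ =>
      sqrt_mul_poissonWeight_le_exp_abs_rescale hd hn (l i)).trans_eq ?_
  rw [Finset.prod_mul_distrib, ← Real.exp_sum, Finset.sum_neg_distrib, Finset.prod_const,
    Finset.card_univ, Fintype.card_fin]

theorem exists_abs_normalizedCount_le (hd : 0 < d) :
    ∃ K : ℝ, 0 ≤ K ∧ ∀ n : ℕ, d ≤ n → ∀ l : Fin d → ℕ,
      |normalizedCount d n l| ≤ K * Real.exp (-((∑ i, |rescale d n (l i)|) / 2)) := by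
  obtain ⟨B, hB⟩ := tendsto_stirlingSeq_div_sqrt_pi.abs.bddAbove_range
  replace hB : ∀ n, |Stirling.stirlingSeq n / √Real.pi| ≤ B := fun n => hB ⟨n, rfl⟩
  have hB0 : 0 ≤ B := (abs_nonneg _).trans (hB 0)
  set c := d.choose 2
  set Q := √(2 * Real.pi) * Real.exp 2
  refine ⟨B * (4 ^ c * c.factorial) * Q ^ d, by positivity, fun n hn l => ?_⟩
  set s := ∑ i, |rescale d n (l i)|
  have hs : 0 ≤ s := Finset.sum_nonneg fun i _ => abs_nonneg _
  have hdiffProd : |diffProd fun i => rescale d n (l i)| ≤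
      4 ^ c * c.factorial * Real.exp (s / 2) :=
    (abs_diffProd_le _).trans (two_mul_pow_le_mul_exp_half hs c)
  have hprod := prod_sqrt_mul_poissonWeight_nonneg d n l
  rw [normalizedCount, abs_mul, abs_mul, abs_of_nonneg hprod]
  calc _ ≤ B * (4 ^ c * c.factorial * Real.exp (s / 2)) * (Q ^ d * Real.exp (-s)) := by
        gcongr
        exacts [hB n, prod_sqrt_mul_poissonWeight_le hd hn l]
    _ = B * (4 ^ c * c.factorial) * Q ^ d * (Real.exp (s / 2) * Real.exp (-s)) := by ring
    _ = B * (4 ^ c * c.factorial) * Q ^ d * Real.exp (-(s / 2)) := by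
        rw [← Real.exp_add]
        ring_nf

end Normalization

section TracelessPoint

variable {m : ℕ}

theorem tracelessPoint_castSucc (x : Fin m → ℝ) (i : Fin m) :
    tracelessPoint (m + 1) x i.castSucc = x i :=
  dif_pos i.2

theorem tracelessPoint_last (x : Fin m → ℝ) :
    tracelessPoint (m + 1) x (Fin.last m) = -∑ k, x k :=
  dif_neg (lt_irrefl m)

theorem sum_tracelessPoint (x : Fin m → ℝ) : ∑ i, tracelessPoint (m + 1) x i = 0 := by
  rw [Fin.sum_univ_castSucc, tracelessPoint_last]
  simp only [tracelessPoint_castSucc]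
  exact add_neg_cancel _

theorem tracelessPoint_comp_castSucc {X : Fin (m + 1) → ℝ} (hX : ∑ i, X i = 0) :
    tracelessPoint (m + 1) (fun i => X i.castSucc) = X := by
  funext i
  refine Fin.lastCases ?_ (fun i => ?_) i
  · rw [tracelessPoint_last, neg_eq_iff_add_eq_zero, ← Fin.sum_univ_castSucc, hX]
  · exact tracelessPoint_castSucc _ i

theorem continuous_tracelessPoint :
    Continuous (tracelessPoint (m + 1) : (Fin m → ℝ) → Fin (m + 1) → ℝ) := by
  refine continuous_pi fun i => ?_
  refine Fin.lastCases ?_ (fun i => ?_) i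
  · simp only [tracelessPoint_last]
    fun_prop
  · simp only [tracelessPoint_castSucc]
    fun_prop

theorem tracelessPoint_mem_tracelessChamber_iff {x : Fin m → ℝ} :
    tracelessPoint (m + 1) x ∈ tracelessChamber (m + 1) ↔ Antitone (tracelessPoint (m + 1) x) :=
  and_iff_left (sum_tracelessPoint x)

theorem measurableSet_tracelessPoint_mem_tracelessChamber (m : ℕ) :
    MeasurableSet {x : Fin m → ℝ | tracelessPoint (m + 1) x ∈ tracelessChamber (m + 1)} := by
  simp only [tracelessPoint_mem_tracelessChamber_iff]
  exact (isClosed_antitone.preimage continuous_tracelessPoint).measurableSet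

theorem isOpen_setOf_strictAnti {ι : Type*} [Finite ι] [Preorder ι] :
    IsOpen {X : ι → ℝ | StrictAnti X} := by
  simp only [StrictAnti, Set.ofPred_forall]
  exact isOpen_iInter_of_finite fun i => isOpen_iInter_of_finite fun j =>
    isOpen_iInter_of_finite fun _ => isOpen_lt (continuous_apply j) (continuous_apply i)

theorem exists_strictAnti_tracelessPoint (m : ℕ) :
    ∃ x : Fin m → ℝ, StrictAnti (tracelessPoint (m + 1) x) := by
  let X : Fin (m + 1) → ℝ := fun i => m - 2 * i
  have hsum : ∑ i, X i = 0 := by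
    have h : ∑ i : Fin (m + 1), (i : ℝ) = (m + 1 : ℕ) * ((m + 1 : ℕ) - 1) / 2 := by
      rw [← Nat.cast_choose_two, ← sum_fin_val, Nat.cast_sum]
    rw [Finset.sum_sub_distrib, ← Finset.mul_sum, h, Finset.sum_const, Finset.card_univ,
      Fintype.card_fin, nsmul_eq_mul]
    push_cast
    ring
  have hstrict : StrictAnti X := fun i j hij => by
    have : (i : ℝ) < j := by exact_mod_cast hij
    simp only [X]
    linarith
  exact ⟨fun i => X i.castSucc, (tracelessPoint_comp_castSucc hsum).symm ▸ hstrict⟩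

variable {d : ℕ} {X : Fin d → ℝ}

theorem chamberDensity_eq_rpow (β : ℝ) (hX : Antitone X) :
    chamberDensity d β X = (Real.exp (-(d / 2 : ℝ) * ∑ i, X i ^ 2) * diffProd X) ^ β := by
  have hsub : ∀ i, ∀ j ∈ Finset.Ioi i, 0 ≤ X i - X j := fun i j hj =>
    sub_nonneg.2 (hX (Finset.mem_Ioi.1 hj).le)
  rw [diffProd, Real.mul_rpow (Real.exp_pos _).le
      (Finset.prod_nonneg fun i _ => Finset.prod_nonneg (hsub i)), ← Real.exp_mul, chamberDensity,
    ← Real.finsetProd_rpow _ _ fun i _ => Finset.prod_nonneg (hsub i)]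
  congr 1
  · congr 1
    ring
  · exact Finset.prod_congr rfl fun i _ => Real.finsetProd_rpow _ _ (hsub i) β

theorem chamberDensity_nonneg (β : ℝ) (hX : Antitone X) : 0 ≤ chamberDensity d β X :=
  mul_nonneg (Real.exp_pos _).le <| Finset.prod_nonneg fun _ _ => Finset.prod_nonneg fun _ hj =>
    Real.rpow_nonneg (sub_nonneg.2 (hX (Finset.mem_Ioi.1 hj).le)) β

theorem chamberDensity_pos (β : ℝ) (hX : StrictAnti X) : 0 < chamberDensity d β X :=
  mul_pos (Real.exp_pos _) <| Finset.prod_pos fun _ _ => Finset.prod_pos fun _ hj =>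
    Real.rpow_pos_of_pos (sub_pos.2 (hX (Finset.mem_Ioi.1 hj))) β

end TracelessPoint

section Rescale

variable {d n : ℕ}

theorem rescale_add (d n : ℕ) (k c : ℝ) : rescale d n (k + c) = rescale d n k + c / √n := by
  rw [rescale, rescale, add_sub_right_comm, add_div]

theorem rescale_lt_rescale_iff (hn : 0 < n) {k l : ℝ} : rescale d n k < rescale d n l ↔ k < l := by
  rw [rescale, rescale, div_lt_div_iff_of_pos_right (by positivity), sub_lt_sub_iff_right]

theorem sum_rescale_eq_zero (hd : 0 < d) {r : Fin d → ℝ} (hr : ∑ i, r i = n) :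
    ∑ i, rescale d n (r i) = 0 := by
  simp only [rescale]
  rw [← Finset.sum_div, Finset.sum_sub_distrib, hr, Finset.sum_const, Finset.card_univ,
    Fintype.card_fin, nsmul_eq_mul, mul_div_cancel₀ _ (by positivity), sub_self, zero_div]

theorem tendsto_const_div_sqrt_atTop (c : ℝ) :
    Tendsto (fun n : ℕ => c / √n) atTop (𝓝 0) :=
  (Real.tendsto_sqrt_atTop.comp tendsto_natCast_atTop_atTop).const_div_atTop c

theorem tendsto_rescale_zero (hd : 0 < d) : Tendsto (fun n => rescale d n 0) atTop atBot := by
  have h : Tendsto (fun n : ℕ => √n / d) atTop atTop :=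
    (Real.tendsto_sqrt_atTop.comp tendsto_natCast_atTop_atTop).atTop_div_const (by positivity)
  refine (tendsto_neg_atTop_atBot.comp h).congr fun n => ?_
  rw [Function.comp_apply, rescale, zero_sub, neg_div, div_right_comm, Real.div_sqrt]

/-- The largest integer `k` with `rescale d n k ≤ y`. -/
noncomputable def unscaleFloor (d n : ℕ) (y : ℝ) : ℤ :=
  ⌊n / d + √n * y⌋

theorem unscaleFloor_eq_iff (hn : 0 < n) {y : ℝ} {k : ℤ} :
    unscaleFloor d n y = k ↔ y ∈ Set.Ico (rescale d n k) (rescale d n (k + 1)) := by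
  have hsqrt : 0 < √(n : ℝ) := by positivity
  rw [unscaleFloor, Int.floor_eq_iff, rescale, rescale, Set.mem_Ico, div_le_iff₀ hsqrt,
    lt_div_iff₀ hsqrt, sub_le_iff_le_add', lt_sub_iff_add_lt', mul_comm y]

theorem abs_sub_rescale_unscaleFloor_le (hn : 0 < n) (y : ℝ) :
    |y - rescale d n (unscaleFloor d n y)| ≤ 1 / √n := by
  obtain ⟨hle, hlt⟩ := (unscaleFloor_eq_iff (d := d) hn (y := y)).1 rfl
  rw [rescale_add] at hlt
  rw [abs_of_nonneg (sub_nonneg.2 hle)]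
  exact sub_le_iff_le_add'.2 hlt.le

theorem tendsto_rescale_unscaleFloor (d : ℕ) (y : ℝ) :
    Tendsto (fun n => rescale d n (unscaleFloor d n y)) atTop (𝓝 y) := by
  rw [tendsto_iff_dist_tendsto_zero]
  refine squeeze_zero' (Eventually.of_forall fun n => dist_nonneg) ?_
    (tendsto_const_div_sqrt_atTop 1)
  filter_upwards [eventually_gt_atTop 0] with n hn
  rw [dist_comm]
  exact abs_sub_rescale_unscaleFloor_le hn y

end Rescale

section ApproxRowLen

variable {m n : ℕ} {x : Fin m → ℝ}

/-- The integer vector with sum `n` whose rescaling approximates `tracelessPoint (m + 1) x`. It is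
the vector of row lengths of a partition when it is antitone and nonnegative. -/
noncomputable def approxRowLen (m n : ℕ) (x : Fin m → ℝ) : Fin (m + 1) → ℤ :=
  Fin.snoc (α := fun _ => ℤ) (fun i => unscaleFloor (m + 1) n (x i))
    (n - ∑ i, unscaleFloor (m + 1) n (x i))

theorem approxRowLen_castSucc (n : ℕ) (x : Fin m → ℝ) (i : Fin m) :
    approxRowLen m n x i.castSucc = unscaleFloor (m + 1) n (x i) :=
  Fin.snoc_castSucc ..

theorem sum_approxRowLen (n : ℕ) (x : Fin m → ℝ) : ∑ i, approxRowLen m n x i = n := by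
  rw [Fin.sum_univ_castSucc, approxRowLen, Fin.snoc_last]
  simp only [Fin.snoc_castSucc]
  exact add_sub_cancel _ _

theorem eq_approxRowLen_iff {r : Fin (m + 1) → ℤ} (hr : ∑ i, r i = n) :
    r = approxRowLen m n x ↔ ∀ i : Fin m, r i.castSucc = unscaleFloor (m + 1) n (x i) := by
  refine ⟨fun h i => by rw [h, approxRowLen_castSucc], fun h => ?_⟩
  have hsum := hr.trans (sum_approxRowLen n x).symm
  simp only [Fin.sum_univ_castSucc, h, approxRowLen_castSucc, add_right_inj] at hsum
  funext i
  refine Fin.lastCases hsum (fun i => ?_) i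
  rw [h, approxRowLen_castSucc]

theorem tendsto_rescale_approxRowLen (x : Fin m → ℝ) (i : Fin (m + 1)) :
    Tendsto (fun n => rescale (m + 1) n (approxRowLen m n x i)) atTop
      (𝓝 (tracelessPoint (m + 1) x i)) := by
  have hfloor : Tendsto (fun n (k : Fin m) =>
      rescale (m + 1) n (unscaleFloor (m + 1) n (x k))) atTop (𝓝 x) :=
    tendsto_pi_nhds.2 fun k => tendsto_rescale_unscaleFloor (m + 1) (x k)
  refine (tendsto_pi_nhds.1 ((continuous_tracelessPoint.tendsto x).comp hfloor) i).congr fun n => ?_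
  have hsum : ∑ i, rescale (m + 1) n (approxRowLen m n x i) = 0 :=
    sum_rescale_eq_zero m.succ_pos (by exact_mod_cast sum_approxRowLen n x)
  refine congrFun (.trans ?_ (tracelessPoint_comp_castSucc hsum)) i
  simp only [Function.comp_apply, approxRowLen_castSucc]
  rfl

theorem eventually_approxRowLen_lt {i j : Fin (m + 1)}
    (h : tracelessPoint (m + 1) x i < tracelessPoint (m + 1) x j) :
    ∀ᶠ n in atTop, approxRowLen m n x i < approxRowLen m n x j := by
  filter_upwards [(tendsto_rescale_approxRowLen x i).eventually_lt
    (tendsto_rescale_approxRowLen x j) h, eventually_gt_atTop 0] with n hlt hn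
  exact_mod_cast (rescale_lt_rescale_iff hn).1 hlt

theorem eventually_approxRowLen_nonneg (x : Fin m → ℝ) :
    ∀ᶠ n in atTop, ∀ i, 0 ≤ approxRowLen m n x i := by
  refine eventually_all.2 fun i => ?_
  filter_upwards [(tendsto_rescale_approxRowLen x i).eventually_const_lt (sub_one_lt _),
    (tendsto_rescale_zero m.succ_pos).eventually_le_atBot (tracelessPoint (m + 1) x i - 1),
    eventually_gt_atTop 0] with n hlt hle hn
  exact_mod_cast ((rescale_lt_rescale_iff hn).1 (hle.trans_lt hlt)).le

theorem eventually_strictAnti_approxRowLen (hx : StrictAnti (tracelessPoint (m + 1) x)) :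
    ∀ᶠ n in atTop, StrictAnti (approxRowLen m n x) := by
  have h : ∀ᶠ n in atTop, ∀ i j : Fin (m + 1), i < j →
      approxRowLen m n x j < approxRowLen m n x i :=
    eventually_all.2 fun i => eventually_all.2 fun j => eventually_imp_distrib_left.2 fun hij =>
      eventually_approxRowLen_lt (hx hij)
  exact h.mono fun n hn i j => hn i j

end ApproxRowLen

section StepDensity

variable {m n : ℕ} {μ : YoungDiagram} {x : Fin m → ℝ} {β : ℝ}

/-- The half-open cube with side `1 / √n` at the point given by the rescaled lengths of the first
`m` rows of `μ`. -/
def rescaledCell (m n : ℕ) (μ : YoungDiagram) : Set (Fin m → ℝ) :=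
  Set.univ.pi fun i =>
    Set.Ico (rescale (m + 1) n (μ.rowLen i)) (rescale (m + 1) n (μ.rowLen i + 1))

theorem measurableSet_rescaledCell (m n : ℕ) (μ : YoungDiagram) :
    MeasurableSet (rescaledCell m n μ) :=
  MeasurableSet.univ_pi fun _ => measurableSet_Ico

theorem volume_rescaledCell (m n : ℕ) (μ : YoungDiagram) :
    volume (rescaledCell m n μ) = ENNReal.ofReal (1 / √n) ^ m := by
  rw [rescaledCell, Real.volume_pi_Ico]
  simp only [rescale_add, add_sub_cancel_left, Finset.prod_const, Finset.card_univ,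
    Fintype.card_fin]

theorem mem_rescaledCell_iff (hn : 0 < n) (hμ : μ ∈ partitionsOfLengthLE n (m + 1)) :
    x ∈ rescaledCell m n μ ↔
      (fun i : Fin (m + 1) => (μ.rowLen i : ℤ)) = approxRowLen m n x := by
  obtain ⟨hcard, hcol⟩ := mem_partitionsOfLengthLE.1 hμ
  have hsum : ∑ i : Fin (m + 1), (μ.rowLen i : ℤ) = n := by
    rw [← hcard, card_eq_sum_rowLen hcol, Nat.cast_sum]
  rw [eq_approxRowLen_iff hsum, rescaledCell, Set.mem_univ_pi]
  refine forall_congr' fun i => ?_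
  rw [eq_comm, unscaleFloor_eq_iff hn, Int.cast_natCast]
  rfl

theorem eq_of_mem_rescaledCell {ν : YoungDiagram} (hn : 0 < n)
    (hμ : μ ∈ partitionsOfLengthLE n (m + 1)) (hν : ν ∈ partitionsOfLengthLE n (m + 1))
    (hxμ : x ∈ rescaledCell m n μ) (hxν : x ∈ rescaledCell m n ν) : μ = ν := by
  have h := ((mem_rescaledCell_iff hn hμ).1 hxμ).trans ((mem_rescaledCell_iff hn hν).1 hxν).symm
  exact youngDiagram_eq_of_rowLen_eq (mem_partitionsOfLengthLE.1 hμ).2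
    (mem_partitionsOfLengthLE.1 hν).2 fun i => Int.natCast_inj.1 (congrFun h i)

theorem exists_mem_rescaledCell (hn : 0 < n) (hanti : Antitone (approxRowLen m n x))
    (hnonneg : ∀ i, 0 ≤ approxRowLen m n x i) :
    ∃ μ ∈ partitionsOfLengthLE n (m + 1), x ∈ rescaledCell m n μ := by
  obtain ⟨μ, hcol, hrow⟩ :=
    exists_youngDiagram_rowLen_eq fun _ _ hij => Int.toNat_le_toNat (hanti hij)
  have hrowLen : (fun i : Fin (m + 1) => (μ.rowLen i : ℤ)) = approxRowLen m n x :=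
    funext fun i => by rw [hrow, Int.toNat_of_nonneg (hnonneg i)]
  have hcard : (μ.card : ℤ) = n := by
    rw [card_eq_sum_rowLen hcol, Nat.cast_sum, hrowLen, sum_approxRowLen]
  have hμ := mem_partitionsOfLengthLE.2 ⟨Int.natCast_inj.1 hcard, hcol⟩
  exact ⟨μ, hμ, (mem_rescaledCell_iff hn hμ).2 hrowLen⟩

/-- The step function on `ℝ^m` whose value on the cell of each partition `μ` of `n` is the
`β`-th power of the normalized number of standard tableaux of shape `μ`. -/
noncomputable def stepDensity (m : ℕ) (β : ℝ) (n : ℕ) (x : Fin m → ℝ) : ℝ :=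
  ∑ μ ∈ partitionsOfLengthLE n (m + 1), (rescaledCell m n μ).indicator
    (fun _ => normalizedCount (m + 1) n (shiftedRowLen (m + 1) μ) ^ β) x

theorem measurable_stepDensity (m n : ℕ) (β : ℝ) : Measurable (stepDensity m β n) :=
  Finset.measurable_sum _ fun μ _ => measurable_const.indicator (measurableSet_rescaledCell m n μ)

theorem stepDensity_of_mem (β : ℝ) (hn : 0 < n) (hμ : μ ∈ partitionsOfLengthLE n (m + 1))
    (hx : x ∈ rescaledCell m n μ) :
    stepDensity m β n x = normalizedCount (m + 1) n (shiftedRowLen (m + 1) μ) ^ β := by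
  rw [stepDensity, Finset.sum_eq_single_of_mem μ hμ, Set.indicator_of_mem hx]
  exact fun ν hν hne => Set.indicator_of_notMem
    (fun hxν => hne (eq_of_mem_rescaledCell hn hν hμ hxν hx)) _

theorem stepDensity_of_forall_notMem (β : ℝ)
    (h : ∀ μ ∈ partitionsOfLengthLE n (m + 1), x ∉ rescaledCell m n μ) :
    stepDensity m β n x = 0 :=
  Finset.sum_eq_zero fun μ hμ => Set.indicator_of_notMem (h μ hμ) _

theorem integral_stepDensity (m n : ℕ) (β : ℝ) :
    ∫ x, stepDensity m β n x = ∑ μ ∈ partitionsOfLengthLE n (m + 1),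
      (1 / √n) ^ m * normalizedCount (m + 1) n (shiftedRowLen (m + 1) μ) ^ β := by
  simp only [stepDensity]
  rw [integral_finsetSum]
  · refine Finset.sum_congr rfl fun μ _ => ?_
    rw [integral_indicator_const _ (measurableSet_rescaledCell m n μ), Measure.real,
      volume_rescaledCell, ENNReal.toReal_pow, ENNReal.toReal_ofReal (by positivity), smul_eq_mul]
  · intro μ _
    refine (integrable_indicator_iff (measurableSet_rescaledCell m n μ)).2 (integrableOn_const ?_)
    rw [volume_rescaledCell]
    exact ENNReal.pow_ne_top ENNReal.ofReal_ne_top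

theorem normalizedCount_shiftedRowLen_nonneg {d : ℕ} (hd : 0 < d) (hn : 0 < n)
    (hμ : μ ∈ partitionsOfLengthLE n d) : 0 ≤ normalizedCount d n (shiftedRowLen d μ) := by
  obtain ⟨hcard, hcol⟩ := mem_partitionsOfLengthLE.1 hμ
  have hgrowth : 0 < growthFactor d n := by
    unfold growthFactor
    positivity
  refine nonneg_of_mul_nonneg_right ?_ hgrowth
  rw [← numStandardTableaux_eq_growthFactor_mul hd hn hcard hcol]
  exact Nat.cast_nonneg _

theorem sum_rpow_eq_mul_integral_stepDensity (m : ℕ) (β : ℝ) (hn : 0 < n) :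
    ∑ μ ∈ partitionsOfLengthLE n (m + 1), (numStandardTableaux μ : ℝ) ^ β =
      growthFactor (m + 1) n ^ β * (n : ℝ) ^ ((m : ℝ) / 2) * ∫ x, stepDensity m β n x := by
  have hpow : (n : ℝ) ^ ((m : ℝ) / 2) * (1 / √n) ^ m = 1 := by
    rw [← one_div_mul_eq_div, Real.rpow_mul (Nat.cast_nonneg n), ← Real.sqrt_eq_rpow,
      Real.rpow_natCast, ← mul_pow, mul_one_div_cancel (by positivity), one_pow]
  rw [integral_stepDensity, ← Finset.mul_sum, ← mul_assoc, mul_assoc (_ ^ β), hpow, mul_one,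
    Finset.mul_sum]
  refine Finset.sum_congr rfl fun μ hμ => ?_
  obtain ⟨hcard, hcol⟩ := mem_partitionsOfLengthLE.1 hμ
  rw [numStandardTableaux_eq_growthFactor_mul m.succ_pos hn hcard hcol,
    Real.mul_rpow (growthFactor_nonneg _ _)
      (normalizedCount_shiftedRowLen_nonneg m.succ_pos hn hμ)]

end StepDensity

section PointwiseLimit

variable {m n : ℕ} {μ : YoungDiagram} {x : Fin m → ℝ} {β : ℝ}

/-- `chamberDensity` in the coordinates `x_1, …, x_m`, extended by zero outside the chamber: the
pointwise limit of `stepDensity`. -/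
noncomputable def limitDensity (m : ℕ) (β : ℝ) : (Fin m → ℝ) → ℝ :=
  {x | tracelessPoint (m + 1) x ∈ tracelessChamber (m + 1)}.indicator
    fun x => chamberDensity (m + 1) β (tracelessPoint (m + 1) x)

theorem limitDensity_of_antitone (β : ℝ) (hx : Antitone (tracelessPoint (m + 1) x)) :
    limitDensity m β x = chamberDensity (m + 1) β (tracelessPoint (m + 1) x) :=
  if_pos (tracelessPoint_mem_tracelessChamber_iff.2 hx)

theorem limitDensity_of_not_antitone (β : ℝ) (hx : ¬Antitone (tracelessPoint (m + 1) x)) :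
    limitDensity m β x = 0 :=
  if_neg (mt tracelessPoint_mem_tracelessChamber_iff.1 hx)

/-- The normalized number of standard tableaux whose row lengths are `approxRowLen m n x`. -/
noncomputable def approxCount (m n : ℕ) (x : Fin m → ℝ) : ℝ :=
  normalizedCount (m + 1) n fun i => (approxRowLen m n x i).toNat + (m + 1 - 1 - i)

theorem normalizedCount_eq_approxCount (hn : 0 < n) (hμ : μ ∈ partitionsOfLengthLE n (m + 1))
    (hx : x ∈ rescaledCell m n μ) :
    normalizedCount (m + 1) n (shiftedRowLen (m + 1) μ) = approxCount m n x := by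
  rw [approxCount, ← (mem_rescaledCell_iff hn hμ).1 hx]
  rfl

theorem tendsto_approxCount (x : Fin m → ℝ) :
    Tendsto (fun n => approxCount m n x) atTop
      (𝓝 (Real.exp (-((m + 1 : ℕ) / 2 : ℝ) * ∑ i, tracelessPoint (m + 1) x i ^ 2) *
        diffProd (tracelessPoint (m + 1) x))) := by
  refine tendsto_normalizedCount m.succ_pos fun i => ?_
  have h := (tendsto_rescale_approxRowLen x i).add
    (tendsto_const_div_sqrt_atTop (m + 1 - 1 - i : ℕ))
  rw [add_zero] at h
  refine h.congr' ?_
  filter_upwards [eventually_approxRowLen_nonneg x] with n hn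
  rw [← rescale_add, Nat.cast_add, ← Int.cast_natCast (Int.toNat _), Int.toNat_of_nonneg (hn i)]

theorem abs_stepDensity_le_abs_approxCount_rpow (β : ℝ) (hn : 0 < n) (x : Fin m → ℝ) :
    |stepDensity m β n x| ≤ |approxCount m n x ^ β| := by
  by_cases h : ∃ μ ∈ partitionsOfLengthLE n (m + 1), x ∈ rescaledCell m n μ
  · obtain ⟨μ, hμ, hx⟩ := h
    rw [stepDensity_of_mem β hn hμ hx, normalizedCount_eq_approxCount hn hμ hx]
  · push Not at h
    rw [stepDensity_of_forall_notMem β h, abs_zero]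
    exact abs_nonneg _

theorem eventually_stepDensity_eq_approxCount_rpow (β : ℝ)
    (hx : StrictAnti (tracelessPoint (m + 1) x)) :
    ∀ᶠ n in atTop, stepDensity m β n x = approxCount m n x ^ β := by
  filter_upwards [eventually_strictAnti_approxRowLen hx, eventually_approxRowLen_nonneg x,
    eventually_gt_atTop 0] with n hanti hnonneg hn
  obtain ⟨μ, hμ, hxμ⟩ := exists_mem_rescaledCell hn hanti.antitone hnonneg
  rw [stepDensity_of_mem β hn hμ hxμ, normalizedCount_eq_approxCount hn hμ hxμ]

theorem eventually_stepDensity_eq_zero (β : ℝ) (hx : ¬Antitone (tracelessPoint (m + 1) x)) :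
    ∀ᶠ n in atTop, stepDensity m β n x = 0 := by
  simp only [Antitone, not_forall, not_le] at hx
  obtain ⟨i, j, hij, hlt⟩ := hx
  filter_upwards [eventually_approxRowLen_lt hlt, eventually_gt_atTop 0] with n happrox hn
  refine stepDensity_of_forall_notMem β fun μ hμ hxμ => happrox.not_ge ?_
  rw [← (mem_rescaledCell_iff hn hμ).1 hxμ]
  exact Int.ofNat_le.2 (μ.rowLen_anti i j hij)

theorem tendsto_stepDensity (hβ : 0 < β) (x : Fin m → ℝ) :
    Tendsto (fun n => stepDensity m β n x) atTop (𝓝 (limitDensity m β x)) := by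
  by_cases hanti : Antitone (tracelessPoint (m + 1) x)
  swap
  · rw [limitDensity_of_not_antitone β hanti]
    exact tendsto_const_nhds.congr' ((eventually_stepDensity_eq_zero β hanti).mono fun _ => .symm)
  have hlim := (tendsto_approxCount x).rpow_const (Or.inr hβ.le : _ ∨ 0 ≤ β)
  rw [← chamberDensity_eq_rpow β hanti, ← limitDensity_of_antitone β hanti] at hlim
  by_cases hstrict : StrictAnti (tracelessPoint (m + 1) x)
  · exact hlim.congr' ((eventually_stepDensity_eq_approxCount_rpow β hstrict).mono fun _ => .symm)
  have hzero : limitDensity m β x = 0 := by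
    simp only [StrictAnti, not_forall, not_lt] at hstrict
    obtain ⟨i, j, hij, hle⟩ := hstrict
    rw [limitDensity_of_antitone β hanti, chamberDensity_eq_rpow β hanti,
      diffProd_eq_zero_of_eq hij (hle.antisymm (hanti hij.le)), mul_zero, Real.zero_rpow hβ.ne']
  rw [hzero] at hlim ⊢
  refine squeeze_zero_norm' ?_ (abs_zero (α := ℝ) ▸ hlim.abs)
  filter_upwards [eventually_gt_atTop 0] with n hn
  exact abs_stepDensity_le_abs_approxCount_rpow β hn x

end PointwiseLimit

section Domination

variable {m n : ℕ} {μ : YoungDiagram} {x : Fin m → ℝ} {β : ℝ}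

theorem integrable_exp_neg_mul_abs {b : ℝ} (hb : 0 < b) :
    Integrable fun x : ℝ => Real.exp (-(b * |x|)) := by
  rw [← integrableOn_univ, ← Set.Iic_union_Ioi (a := (0 : ℝ))]
  refine IntegrableOn.union ?_ ?_
  · refine (integrableOn_exp_mul_Iic hb 0).congr_fun (fun x hx => ?_) measurableSet_Iic
    simp only [abs_of_nonpos (Set.mem_Iic.1 hx), mul_neg, neg_neg]
  · refine (integrableOn_exp_mul_Ioi (neg_neg_of_pos hb) 0).congr_fun (fun x hx => ?_)
      measurableSet_Ioi
    simp only [abs_of_pos (Set.mem_Ioi.1 hx), neg_mul]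

theorem integrable_exp_neg_mul_sum_abs {ι : Type*} [Fintype ι] {b : ℝ} (hb : 0 < b) :
    Integrable fun x : ι → ℝ => Real.exp (-(b * ∑ i, |x i|)) := by
  have h := Integrable.fintype_prod (μ := fun _ : ι => (volume : Measure ℝ))
    (f := fun _ x => Real.exp (-(b * |x|))) fun _ => integrable_exp_neg_mul_abs hb
  refine h.congr (Eventually.of_forall fun x => ?_)
  simp only [← Real.exp_sum, Finset.sum_neg_distrib, Finset.mul_sum]

theorem abs_le_abs_rescale_shiftedRowLen_add (hn : 0 < n) (hx : x ∈ rescaledCell m n μ)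
    (i : Fin m) :
    |x i| ≤ |rescale (m + 1) n (shiftedRowLen (m + 1) μ i.castSucc)| + (m + 1) := by
  obtain ⟨hle, hlt⟩ := hx i (Set.mem_univ i)
  have hsqrt : 1 ≤ √(n : ℝ) := Real.one_le_sqrt.2 (by exact_mod_cast hn)
  have hone : 1 / √(n : ℝ) ≤ 1 := (div_le_one (zero_lt_one.trans_le hsqrt)).2 hsqrt
  have hshift : ((m - i : ℕ) : ℝ) / √n ≤ m :=
    (div_le_self (Nat.cast_nonneg _) hsqrt).trans (by exact_mod_cast Nat.sub_le m i)
  have hshift_nonneg : 0 ≤ ((m - i : ℕ) : ℝ) / √n := by positivity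
  have heq : rescale (m + 1) n (shiftedRowLen (m + 1) μ i.castSucc) =
      rescale (m + 1) n (μ.rowLen i) + (m - i : ℕ) / √n := by
    rw [← rescale_add, ← Nat.cast_add]
    rfl
  rw [rescale_add] at hlt
  rw [← sub_le_iff_le_add']
  refine (abs_sub_abs_le_abs_sub _ _).trans (abs_le.2 ⟨?_, ?_⟩) <;> linarith

theorem sum_abs_le_sum_abs_rescale_shiftedRowLen_add (hn : 0 < n)
    (hx : x ∈ rescaledCell m n μ) :
    ∑ i, |x i| ≤ ∑ i, |rescale (m + 1) n (shiftedRowLen (m + 1) μ i)| + m * (m + 1) := by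
  calc ∑ i, |x i|
      ≤ ∑ i : Fin m, (|rescale (m + 1) n (shiftedRowLen (m + 1) μ i.castSucc)| + (m + 1)) :=
        Finset.sum_le_sum fun i _ => abs_le_abs_rescale_shiftedRowLen_add hn hx i
    _ = ∑ i : Fin m, |rescale (m + 1) n (shiftedRowLen (m + 1) μ i.castSucc)| + m * (m + 1) := by
        rw [Finset.sum_add_distrib, Finset.sum_const, Finset.card_univ, Fintype.card_fin,
          nsmul_eq_mul]
    _ ≤ ∑ i, |rescale (m + 1) n (shiftedRowLen (m + 1) μ i)| + m * (m + 1) := by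
        rw [Fin.sum_univ_castSucc (n := m)]
        gcongr
        exact le_add_of_nonneg_right (abs_nonneg _)

theorem exists_abs_stepDensity_le (m : ℕ) (hβ : 0 ≤ β) :
    ∃ K : ℝ, ∀ n : ℕ, m + 1 ≤ n → ∀ x,
      |stepDensity m β n x| ≤ K * Real.exp (-(β / 2 * ∑ i, |x i|)) := by
  obtain ⟨K, hK, hbound⟩ := exists_abs_normalizedCount_le m.succ_pos
  refine ⟨K ^ β * Real.exp (β / 2 * (m * (m + 1))), fun n hn x => ?_⟩
  have hn0 : 0 < n := m.succ_pos.trans_le hn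
  by_cases h : ∃ μ ∈ partitionsOfLengthLE n (m + 1), x ∈ rescaledCell m n μ
  swap
  · push Not at h
    rw [stepDensity_of_forall_notMem β h, abs_zero]
    positivity
  obtain ⟨μ, hμ, hx⟩ := h
  have hsum := sum_abs_le_sum_abs_rescale_shiftedRowLen_add hn0 hx
  rw [stepDensity_of_mem β hn0 hμ hx]
  calc |normalizedCount (m + 1) n (shiftedRowLen (m + 1) μ) ^ β|
      ≤ |normalizedCount (m + 1) n (shiftedRowLen (m + 1) μ)| ^ β := Real.abs_rpow_le_abs_rpow _ _
    _ ≤ (K * Real.exp (-((∑ i, |x i| - m * (m + 1)) / 2))) ^ β := by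
        refine Real.rpow_le_rpow (abs_nonneg _) ((hbound n hn _).trans ?_) hβ
        gcongr
        linarith
    _ = K ^ β * Real.exp (β / 2 * (m * (m + 1))) * Real.exp (-(β / 2 * ∑ i, |x i|)) := by
        rw [Real.mul_rpow hK (Real.exp_pos _).le, ← Real.exp_mul, mul_assoc, ← Real.exp_add]
        ring_nf

theorem tendsto_integral_stepDensity (m : ℕ) (hβ : 0 < β) :
    Tendsto (fun n => ∫ x, stepDensity m β n x) atTop (𝓝 (∫ x, limitDensity m β x)) := by
  obtain ⟨K, hK⟩ := exists_abs_stepDensity_le m hβ.le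
  refine tendsto_integral_filter_of_dominated_convergence _
    (Eventually.of_forall fun n => (measurable_stepDensity m n β).aestronglyMeasurable) ?_
    ((integrable_exp_neg_mul_sum_abs (half_pos hβ)).const_mul K)
    (Eventually.of_forall (tendsto_stepDensity hβ))
  filter_upwards [eventually_ge_atTop (m + 1)] with n hn
  exact Eventually.of_forall (hK n hn)

end Domination

section ChamberIntegral

variable {m : ℕ} {β : ℝ}

theorem chamberIntegral_eq_integral_limitDensity (m : ℕ) (β : ℝ) :
    chamberIntegral (m + 1) β = ∫ x, limitDensity m β x :=
  (integral_indicator (measurableSet_tracelessPoint_mem_tracelessChamber m)).symm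

theorem limitDensity_nonneg (β : ℝ) (x : Fin m → ℝ) : 0 ≤ limitDensity m β x :=
  Set.indicator_nonneg (fun _ hx => chamberDensity_nonneg β hx.1) x

theorem integrable_limitDensity (m : ℕ) (hβ : 0 < β) : Integrable (limitDensity m β) := by
  obtain ⟨K, hK⟩ := exists_abs_stepDensity_le m hβ.le
  refine ((integrable_exp_neg_mul_sum_abs (half_pos hβ)).const_mul K).mono' ?_
    (Eventually.of_forall fun x => ?_)
  · exact aestronglyMeasurable_of_tendsto_ae atTop
      (fun n => (measurable_stepDensity m n β).aestronglyMeasurable)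
      (Eventually.of_forall (tendsto_stepDensity hβ))
  · refine le_of_tendsto (tendsto_stepDensity hβ x).norm ?_
    filter_upwards [eventually_ge_atTop (m + 1)] with n hn using hK n hn x

theorem chamberIntegral_pos (m : ℕ) (hβ : 0 < β) : 0 < chamberIntegral (m + 1) β := by
  rw [chamberIntegral_eq_integral_limitDensity,
    integral_pos_iff_support_of_nonneg (limitDensity_nonneg β) (integrable_limitDensity m hβ)]
  refine ((isOpen_setOf_strictAnti.preimage continuous_tracelessPoint).measure_pos volume
    (exists_strictAnti_tracelessPoint m)).trans_le (measure_mono fun x hx => ?_)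
  rw [Function.mem_support, limitDensity_of_antitone β (StrictAnti.antitone hx)]
  exact (chamberDensity_pos β hx).ne'

end ChamberIntegral

theorem theorem2 (β : ℝ) (hβ : 0 < β) (d : ℕ) (hd : 0 < d) :
    Asymptotics.IsEquivalent Filter.atTop
      (fun n : ℕ => ∑ μ ∈ partitionsOfLengthLE n d, (numStandardTableaux μ : ℝ) ^ β)
      (fun n : ℕ =>
        ((2 * Real.pi) ^ (-(((d : ℝ) - 1) / 2)) * (d : ℝ) ^ ((n : ℝ) + (d : ℝ) ^ 2 / 2) *
            (n : ℝ) ^ (-(((d : ℝ) - 1) * ((d : ℝ) + 2) / 4))) ^ β *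
          (n : ℝ) ^ (((d : ℝ) - 1) / 2) * chamberIntegral d β) := by
  obtain ⟨m, rfl⟩ := Nat.exists_eq_add_one.2 hd
  have hlim : Asymptotics.IsEquivalent atTop (fun n => ∫ x, stepDensity m β n x)
      (fun _ => chamberIntegral (m + 1) β) := by
    refine (Asymptotics.isEquivalent_const_iff_tendsto (chamberIntegral_pos m hβ).ne').2 ?_
    rw [chamberIntegral_eq_integral_limitDensity]
    exact tendsto_integral_stepDensity m hβ
  have hmul := (Asymptotics.IsEquivalent.refl (u := fun n : ℕ =>
    growthFactor (m + 1) n ^ β * (n : ℝ) ^ (((m + 1 : ℕ) - 1 : ℝ) / 2))).mul hlim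
  refine hmul.congr_left ?_
  filter_upwards [eventually_gt_atTop 0] with n hn
  rw [sum_rpow_eq_mul_integral_stepDensity m β hn, Nat.cast_add_one, add_sub_cancel_right]
  rfl
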